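/- **Problem.** Let $\mathcal A$ be a finite set of nodes, node $\alpha$ having $n_\alpha$ poses $X_i^\alpha=[\,t_i^\alpha\ R_i^\alpha\,]\in\mathbb R^{d\times(d+1)}$, let $X^\alpha$ collect the poses of node $\alpha$ and let $X=[X^1\cdots X^{|\mathcal A|}]$, all with the Frobenius inner product and norm. Let $\mathcal X^\alpha$ be the set of $X^\alpha$ with all $R_i^\alpha\in SO(d)$, and $\mathcal X=\prod_\alpha\mathcal X^\alpha$. A finite set $\overrightarrow{\mathcal E}$ of directed edges $((\alpha,i),(\beta,j))$ is given, with measurements $(\tilde t_{ij}^{\alpha\beta},\tilde R_{ij}^{\alpha\beta})\in\mathbb R^d\times SO(d)$ and weights $\kappa_{ij}^{\alpha\beta},\tau_{ij}^{\alpha\beta}\ge0$. Write $\overrightarrow{\mathcal E}^{\alpha\beta}=\{(i,j):((\alpha,i),(\beta,j))\in\overrightarrow{\mathcal E}\}$ and let $\mathcal N^\alpha$ be the set of $\beta\ne\alpha$ with $\overrightarrow{\mathcal E}^{\alpha\beta}\cup\overrightarrow{\mathcal E}^{\beta\alpha}\neq\emptyset$ (each node can communicate with these neighbors). Put $$\|X\|_{M_{ij}^{\alpha\beta}}^2=\kappa_{ij}^{\alpha\beta}\|R_i^\alpha\tilde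 R_{ij}^{\alpha\beta}-R_j^\beta\|^2+\tau_{ij}^{\alpha\beta}\|R_i^\alpha\tilde t_{ij}^{\alpha\beta}+t_i^\alpha-t_j^\beta\|^2,$$ $$\|X\|_{\Omega_{ij}^{\alpha\beta}}^2=2\big(\kappa_{ij}^{\alpha\beta}\|R_i^\alpha\|^2+\kappa_{ij}^{\alpha\beta}\|R_j^\beta\|^2+\tau_{ij}^{\alpha\beta}\|R_i^\alpha\tilde t_{ij}^{\alpha\beta}+t_i^\alpha\|^2+\tau_{ij}^{\alpha\beta}\|t_j^\beta\|^2\big).$$ Let $F_{ij}^{\alpha\alpha}(X)=\frac12\|X\|^2_{M_{ij}^{\alpha\alpha}}$, $F_{ij}^{\alpha\beta}(X)=\frac12\rho(\|X\|^2_{M_{ij}^{\alpha\beta}})$ for $\alpha\ne\beta$, and let $F$ be the sum of all $F_{ij}^{\alpha\beta}$ over the edges. $\nabla$ is the Euclidean gradient and $\operatorname{grad}F(X)$ the Riemannian gradient on the embedded submanifold $\mathcal X$ (the orthogonal projection of $\nabla F(X)$ to the tangent space of $\mathcal X$ at $X$). **Loss kernel.** $\rho:[0,\infty)\to\mathbb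 R$ is nonnegative with $\rho(s)=0$ iff $s=0$, continuously differentiable, concave, $0\le\rho'\le1$, $\rho'(0)=1$, and $Z\mapsto\rho(\|Z\|^2)$ has Lipschitz continuous gradient on $\mathbb R^{m\times n}$ (for all $m,n$). **Surrogates.** Let $\omega_{ij}^{\alpha\alpha}(X)=1$ and $\omega_{ij}^{\alpha\beta}(X)=\rho'(\|X\|^2_{M_{ij}^{\alpha\beta}})$ for $\alpha\neq\beta$. Given $X^{(k)}$, let $\omega_{ij}^{\alpha\beta(k)}=\omega_{ij}^{\alpha\beta}(X^{(k)})$; let $\Gamma^{(k)}$ be the matrix $\sum_{\text{edges in a node}}M_{ij}^{\alpha\alpha}+\sum_{\text{edges between nodes}}\omega_{ij}^{\alpha\beta(k)}\Omega_{ij}^{\alpha\beta}+\xi I$ and $\Pi^{(k)}$ the matrix $\sum_{\text{edges in a node}}\Omega_{ij}^{\alpha\alpha}+\sum_{\text{edges between nodes}}\omega_{ij}^{\alpha\beta(k)}\Omega_{ij}^{\alpha\beta}+\zeta I$. These are block diagonal over the nodes, with blocks $\Gamma^{\alpha(k)},\Pi^{\alpha(k)}$. For $Z\in\{X^{(k)},Y^{(k)}\}$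 put $$G^\alpha(X^\alpha|Z)=\tfrac12\|X^\alpha-Z^\alpha\|^2_{\Gamma^{\alpha(k)}}+\langle\nabla_{X^\alpha}F(Z),X^\alpha-Z^\alpha\rangle,\quad H^\alpha(X^\alpha|Z)=\tfrac12\|X^\alpha-Z^\alpha\|^2_{\Pi^{\alpha(k)}}+\langle\nabla_{X^\alpha}F(Z),X^\alpha-Z^\alpha\rangle.$$ **Local objective values.** For $\alpha\ne\beta$ let $F^{\alpha\beta}$ be the sum of all $F_{ij}^{\alpha\beta}$ and $F_{ji}^{\beta\alpha}$ over the edges between the two nodes, $E^{\alpha\beta}(X|Z)$ the corresponding sum of $$E_{ij}^{\alpha\beta}(X|Z)=\tfrac12\omega_{ij}^{\alpha\beta}(Z)\|X-Z\|^2_{\Omega_{ij}^{\alpha\beta}}+\langle\nabla F_{ij}^{\alpha\beta}(Z),X-Z\rangle+F_{ij}^{\alpha\beta}(Z)$$ (similarly $E_{ji}^{\beta\alpha}$), and $E^{\alpha|\beta}(X^\alpha|Z)=\frac12\|X^\alpha-Z^\alpha\|^2_{\Omega^{\alpha|\beta}}+\langle\nabla_{X^\alpha}F^{\alpha\beta}(Z),X^\alpha-Z^\alpha\rangle$,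 where $\Omega^{\alpha|\beta}$ is the $\alpha$-block of the sum of the matrices $\omega(Z)\,\Omega$ over the edges between $\alpha$ and $\beta$. Let $F^{\alpha|\beta(0)}=\frac12F^{\alpha\beta}(X^{(0)})$ and $$F^{\alpha|\beta(k+1)}=E^{\alpha|\beta}(X^{\alpha(k+1)}|X^{(k)})+F^{\alpha|\beta(k)}+\tfrac12\big(F^{\alpha\beta}(X^{(k+1)})-E^{\alpha\beta}(X^{(k+1)}|X^{(k)})\big).$$ Let $F^{\alpha(k)}=\sum_{(i,j)\in\overrightarrow{\mathcal E}^{\alpha\alpha}}F_{ij}^{\alpha\alpha}(X^{(k)})+\sum_{\beta\in\mathcal N^\alpha}F^{\alpha|\beta(k)}$, $\overline F^{\alpha(-1)}=F^{\alpha(0)}$, $\overline F^{\alpha(k)}=(1-\eta)\overline F^{\alpha(k-1)}+\eta F^{\alpha(k)}$, and globally $\overline F^{(-1)}=F(X^{(0)})$, $\overline F^{(k)}=(1-\eta)\overline F^{(k-1)}+\eta F(X^{(k)})$. **Algorithm.** Let $\eta\in(0,1]$, $\zeta\ge\xi\ge0$, $\phi\in(0,1]$, $\psi>0$, $X^{(-1)}=X^{(0)}\in\mathcal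 X$, $s^{\alpha(0)}=1$. For $k=0,1,2,\dots$ and every node $\alpha$: 1. $s^{\alpha(k+1)}=\frac12\big(\sqrt{4(s^{\alpha(k)})^2+1}+1\big)$, $\lambda^{\alpha(k)}=(s^{\alpha(k)}-1)/s^{\alpha(k+1)}$, $Y^{\alpha(k)}=X^{\alpha(k)}+\lambda^{\alpha(k)}(X^{\alpha(k)}-X^{\alpha(k-1)})$. 2. Let $X^{\alpha(k+\frac12)}$ be a minimizer of $H^\alpha(\cdot|Y^{(k)})$ over $\mathcal X^\alpha$, and let $X^{\alpha(k+1)}\in\mathcal X^\alpha$ be the outcome of an inexact minimization of $G^\alpha(\cdot|Y^{(k)})$ started at $X^{\alpha(k+\frac12)}$. Throughout, $G^{\alpha(k+\frac12)}$ and $G^{\alpha(k+1)}$ denote $G^\alpha(\cdot|X^{(k)})+F^{\alpha(k)}$ at the current $X^{\alpha(k+\frac12)}$ and $X^{\alpha(k+1)}$. 3. If $G^{\alpha(k+\frac12)}>\overline F^{\alpha(k)}-\psi\|X^{\alpha(k+\frac12)}-X^{\alpha(k)}\|^2$, replace $X^{\alpha(k+\frac12)}$ by a minimizer of $H^\alpha(\cdot|X^{(k)})$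 over $\mathcal X^\alpha$. 4. If $G^{\alpha(k+1)}>\overline F^{\alpha(k)}$, replace $X^{\alpha(k+1)}$ by the outcome in $\mathcal X^\alpha$ of an inexact minimization of $G^\alpha(\cdot|X^{(k)})$ started at $X^{\alpha(k+\frac12)}$, and set $s^{\alpha(k)}\leftarrow\max\{\frac12s^{\alpha(k)},1\}$. (The momentum value $s^{\alpha(k+1)}$ used in the next iteration may be left as it is, or replaced by $\max\{\frac12s^{\alpha(k+1)},1\}$, or recomputed from the new $s^{\alpha(k)}$.) 5. If $\overline F^{\alpha(k)}-G^{\alpha(k+1)}<\phi\,(\overline F^{\alpha(k)}-G^{\alpha(k+\frac12)})$, replace $X^{\alpha(k+1)}$ by $X^{\alpha(k+\frac12)}$. The outcome of an inexact minimization may be any point of $\mathcal X^\alpha$; in particular every solver that does not increase the value of $G^\alpha$ is covered. **Claim.** There is $\epsilon>0$, depending only on the problem data, on $\rho$ and on the parameters, such that for all sequences $\{X^{(k)}\},\{X^{(k+\frac12)}\}$ generated by the algorithm: (a) $\overline F^{(k)}$ is nonincreasing; (b) there is $F^\infty\in\mathbb R$ with $F(X^{(k)})\to F^\infty$ and $\overline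 F^{(k)}\to F^\infty$; and, if $\zeta>\xi>0$, (c) $\|X^{(k+1)}-X^{(k)}\|\to0$; (d) $\|X^{(k+\frac12)}-X^{(k)}\|\to0$; (e) for every integer $K\ge1$, $\displaystyle\min_{0\le k<K}\|\operatorname{grad}F(X^{(k+\frac12)})\|\le2\sqrt{\frac1\epsilon\cdot\frac{F(X^{(0)})-F^\infty}{K+1}}$; (f) $\operatorname{grad}F(X^{(k)})\to0$ and $\operatorname{grad}F(X^{(k+\frac12)})\to0$. -/

import Mathlib

open Filter Topology

namespace DistPGO

noncomputable section

/-! ### Poses, configurations, Frobenius norms -/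

/-- The space of real `m × n` matrices with the Frobenius norm and inner product `trace (X Yᵀ)`. -/
abbrev Mat (m n : ℕ) : Type := EuclideanSpace ℝ (Fin m × Fin n)

/-- Ambient space of one pose `[t R]`, a `d × (d+1)` matrix. -/
abbrev Pose (d : ℕ) : Type := Mat d (d + 1)

/-- Ambient space of the `m` poses of one node: `d × (d+1)m` matrices, Frobenius norm. -/
abbrev NodeConf (d m : ℕ) : Type := PiLp 2 (fun _ : Fin m => Pose d)

/-- Ambient space of all poses `X = [X¹ ⋯ X^|A|]`, with the Frobenius norm; the node `α` has
`n α` poses, `X α` is the block of the node `α`, and `X α i` its `i`-th pose. -/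
abbrev Conf {A : Type*} (d : ℕ) (n : A → ℕ) : Type _ := PiLp 2 (fun α : A => NodeConf d (n α))

/-- The vertices `(α, i)` of the pose graph. -/
abbrev Vertex {A : Type*} (n : A → ℕ) : Type _ := Σ α : A, Fin (n α)

/-- The translation `t` of `[t R]`. -/
def transl {d : ℕ} (x : Pose d) : Fin d → ℝ := fun a => x (a, 0)

/-- The matrix `R` of `[t R]`. -/
def rotat {d : ℕ} (x : Pose d) : Matrix (Fin d) (Fin d) ℝ := Matrix.of fun a b => x (a, b.succ)

/-- Squared Frobenius norm of a matrix. -/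
def frobSq {d : ℕ} (M : Matrix (Fin d) (Fin d) ℝ) : ℝ := (M * M.transpose).trace

/-- Squared Euclidean norm of a vector. -/
def vecSq {d : ℕ} (v : Fin d → ℝ) : ℝ := v ⬝ᵥ v

/-- The feasible set `𝒳^α` of one node: all matrix parts lie in `SO(d)`. -/
def nodeFeasible (d m : ℕ) : Set (NodeConf d m) :=
  {x | ∀ i, rotat (x i) ∈ Matrix.specialOrthogonalGroup (Fin d) ℝ}

/-- The feasible set `𝒳`, the product of the sets `𝒳^α`. -/
def feasible {A : Type*} (d : ℕ) (n : A → ℕ) : Set (Conf d n) :=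
  {X | ∀ α, X α ∈ nodeFeasible d (n α)}

/-! ### Loss kernels -/

/-- Loss kernels `ρ : [0, ∞) → ℝ`; the values of `ρ` at negative reals play no role. -/
structure IsLossKernel (ρ : ℝ → ℝ) : Prop where
  nonneg : ∀ s, 0 ≤ s → 0 ≤ ρ s
  eq_zero_iff : ∀ s, 0 ≤ s → (ρ s = 0 ↔ s = 0)
  contDiffOn : ContDiffOn ℝ 1 ρ (Set.Ici 0)
  concaveOn : ConcaveOn ℝ (Set.Ici 0) ρ
  deriv_nonneg : ∀ s, 0 ≤ s → 0 ≤ derivWithin ρ (Set.Ici 0) s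
  deriv_le_one : ∀ s, 0 ≤ s → derivWithin ρ (Set.Ici 0) s ≤ 1
  deriv_zero : derivWithin ρ (Set.Ici 0) 0 = 1
  lipschitz_gradient : ∀ m n : ℕ, ∃ μ : ℝ, 0 < μ ∧ ∀ X X' : Mat m n,
    ‖gradient (fun Z : Mat m n => ρ (‖Z‖ ^ 2)) X - gradient (fun Z : Mat m n => ρ (‖Z‖ ^ 2)) X'‖
      ≤ μ * ‖X - X'‖

/-! ### The pose graph and its objective function -/

/-- The data of a distributed pose graph optimization problem: the directed edges and, for every
edge `e = ((α, i), (β, j))`, the measurement `(t̃, R̃) ∈ SE(d)` and the weights `κ` and `τ`. -/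
structure PoseGraph {A : Type*} (d : ℕ) (n : A → ℕ) where
  edges : Finset (Vertex n × Vertex n)
  measT : Vertex n × Vertex n → Fin d → ℝ
  measR : Vertex n × Vertex n → Matrix.specialOrthogonalGroup (Fin d) ℝ
  κ : Vertex n × Vertex n → ℝ
  τ : Vertex n × Vertex n → ℝ
  κ_nonneg : ∀ e ∈ edges, 0 ≤ κ e
  τ_nonneg : ∀ e ∈ edges, 0 ≤ τ e

variable {A : Type*} [Fintype A] [DecidableEq A] {d : ℕ} {n : A → ℕ}

/-- The pose of the configuration `X` at the vertex `v`. -/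
def poseAt (X : Conf d n) (v : Vertex n) : Pose d := X v.1 v.2

namespace PoseGraph

variable (P : PoseGraph d n) (ρ : ℝ → ℝ)

/-- `‖X‖²` for the seminorm given by `M_ij^{αβ}`, `e = ((α, i), (β, j))`:
`κ ‖R_i R̃ - R_j‖² + τ ‖R_i t̃ + t_i - t_j‖²`. -/
def sqM (e : Vertex n × Vertex n) (X : Conf d n) : ℝ :=
  P.κ e * frobSq (rotat (poseAt X e.1) * (P.measR e : Matrix (Fin d) (Fin d) ℝ)
      - rotat (poseAt X e.2)) +
    P.τ e * vecSq ((rotat (poseAt X e.1)).mulVec (P.measT e)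
      + transl (poseAt X e.1) - transl (poseAt X e.2))

/-- `‖X‖²` for the seminorm given by `Ω_ij^{αβ}`, `e = ((α, i), (β, j))`:
`2 (κ ‖R_i‖² + κ ‖R_j‖² + τ ‖R_i t̃ + t_i‖² + τ ‖t_j‖²)`. -/
def sqOmega (e : Vertex n × Vertex n) (X : Conf d n) : ℝ :=
  2 * (P.κ e * frobSq (rotat (poseAt X e.1)) + P.κ e * frobSq (rotat (poseAt X e.2)) +
    P.τ e * vecSq ((rotat (poseAt X e.1)).mulVec (P.measT e) + transl (poseAt X e.1)) +
    P.τ e * vecSq (transl (poseAt X e.2)))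

/-- The set of edges from node `α` to node `β`. -/
def edgesBetween (α β : A) : Finset (Vertex n × Vertex n) :=
  P.edges.filter fun e => e.1.1 = α ∧ e.2.1 = β

/-- The neighbours `𝒩^α` of the node `α`. -/
def neighbors (α : A) : Finset A :=
  Finset.univ.filter fun β =>
    α ≠ β ∧ ((P.edgesBetween α β).Nonempty ∨ (P.edgesBetween β α).Nonempty)

/-- The edges inside a node. -/
def intraEdges : Finset (Vertex n × Vertex n) := P.edges.filter fun e => e.1.1 = e.2.1

/-- The edges between different nodes. -/
def interEdges : Finset (Vertex n × Vertex n) := P.edges.filter fun e => e.1.1 ≠ e.2.1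

/-- `F_ij^{αβ}(X)`: `½ ‖X‖²_M` inside a node, `½ ρ(‖X‖²_M)` between different nodes. -/
def edgeF (e : Vertex n × Vertex n) (X : Conf d n) : ℝ :=
  if e.1.1 = e.2.1 then 1 / 2 * P.sqM e X else 1 / 2 * ρ (P.sqM e X)

/-- The weight `ω_ij^{αβ}` evaluated at `X`. -/
def weight (e : Vertex n × Vertex n) (X : Conf d n) : ℝ :=
  if e.1.1 = e.2.1 then 1 else derivWithin ρ (Set.Ici 0) (P.sqM e X)

/-- The objective function `F`. -/
def objective (X : Conf d n) : ℝ := ∑ e ∈ P.edges, P.edgeF ρ e X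

/-- `E_ij^{αβ}(X | Z)`, with the weight evaluated at `Z`. -/
def edgeE (e : Vertex n × Vertex n) (X Z : Conf d n) : ℝ :=
  1 / 2 * P.weight ρ e Z * P.sqOmega e (X - Z) + inner ℝ (gradient (P.edgeF ρ e) Z) (X - Z)
    + P.edgeF ρ e Z

/-! ### Surrogates of a single node

`Γ`, `Π` and `∑ ω Ω` are block diagonal; the quadratic form of the block of the node `α` at `x` is
the quadratic form of the whole matrix at the configuration that is `x` at `α`, zero elsewhere. -/

/-- The configuration that is `x` at the node `α` and zero at the other nodes. -/
def embed (α : A) (x : NodeConf d (n α)) : Conf d n := WithLp.toLp 2 (Pi.single α x)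

/-- `‖x‖²` for `Γ^α`, the weights being evaluated at `X`. -/
def sqGamma (ξ : ℝ) (X : Conf d n) (α : A) (x : NodeConf d (n α)) : ℝ :=
  ∑ e ∈ P.intraEdges, P.sqM e (embed α x)
    + ∑ e ∈ P.interEdges, P.weight ρ e X * P.sqOmega e (embed α x) + ξ * ‖x‖ ^ 2

/-- `‖x‖²` for `Π^α`, the weights being evaluated at `X`. -/
def sqPi (ζ : ℝ) (X : Conf d n) (α : A) (x : NodeConf d (n α)) : ℝ :=
  ∑ e ∈ P.intraEdges, P.sqOmega e (embed α x)
    + ∑ e ∈ P.interEdges, P.weight ρ e X * P.sqOmega e (embed α x) + ζ * ‖x‖ ^ 2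

/-- `G^α(x | Z)`, the weights being evaluated at `X`. -/
def nodeG (ξ : ℝ) (X Z : Conf d n) (α : A) (x : NodeConf d (n α)) : ℝ :=
  1 / 2 * P.sqGamma ρ ξ X α (x - Z α) + inner ℝ (gradient (P.objective ρ) Z α) (x - Z α)

/-- `H^α(x | Z)`, the weights being evaluated at `X`. -/
def nodeH (ζ : ℝ) (X Z : Conf d n) (α : A) (x : NodeConf d (n α)) : ℝ :=
  1 / 2 * P.sqPi ρ ζ X α (x - Z α) + inner ℝ (gradient (P.objective ρ) Z α) (x - Z α)

/-- `x` minimizes `H^α(· | Z)` over `𝒳^α`. -/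
def IsArgminH (ζ : ℝ) (X Z : Conf d n) (α : A) (x : NodeConf d (n α)) : Prop :=
  x ∈ nodeFeasible d (n α) ∧ ∀ y ∈ nodeFeasible d (n α), P.nodeH ρ ζ X Z α x ≤ P.nodeH ρ ζ X Z α y

/-! ### Local bookkeeping of the objective values -/

/-- `F^{αβ}(X)` for different nodes `α`, `β`. -/
def pairF (α β : A) (X : Conf d n) : ℝ :=
  ∑ e ∈ P.edgesBetween α β, P.edgeF ρ e X + ∑ e ∈ P.edgesBetween β α, P.edgeF ρ e X

/-- `E^{αβ}(X | Z)` for different nodes `α`, `β`. -/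
def pairE (α β : A) (X Z : Conf d n) : ℝ :=
  ∑ e ∈ P.edgesBetween α β, P.edgeE ρ e X Z + ∑ e ∈ P.edgesBetween β α, P.edgeE ρ e X Z

/-- `F^{αα}(X^α)`. -/
def selfF (α : A) (x : NodeConf d (n α)) : ℝ :=
  ∑ e ∈ P.edgesBetween α α, P.edgeF ρ e (embed α x)

/-- `‖x‖²` for `Ω^{α|β}`, the weights being evaluated at `Z`. -/
def sqOmegaPart (Z : Conf d n) (α β : A) (x : NodeConf d (n α)) : ℝ :=
  ∑ e ∈ P.edgesBetween α β, P.weight ρ e Z * P.sqOmega e (embed α x)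
    + ∑ e ∈ P.edgesBetween β α, P.weight ρ e Z * P.sqOmega e (embed α x)

/-- `E^{α|β}(x | Z)`. -/
def partE (α β : A) (x : NodeConf d (n α)) (Z : Conf d n) : ℝ :=
  1 / 2 * P.sqOmegaPart ρ Z α β (x - Z α) + inner ℝ (gradient (P.pairF ρ α β) Z α) (x - Z α)

/-- `F^{α|β(k)}` along the iterates `X^{(0)}, X^{(1)}, …`. -/
def partF (X : ℕ → Conf d n) (α β : A) : ℕ → ℝ
  | 0 => 1 / 2 * P.pairF ρ α β (X 0)
  | k + 1 => (P.partE ρ α β (X (k + 1) α) (X k) + partF X α β k)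
      + 1 / 2 * (P.pairF ρ α β (X (k + 1)) - P.pairE ρ α β (X (k + 1)) (X k))

/-- `F^{α(k)}`. -/
def nodeF (X : ℕ → Conf d n) (α : A) (k : ℕ) : ℝ :=
  P.selfF ρ α (X k α) + ∑ β ∈ P.neighbors α, P.partF ρ X α β k

/-- `F̄^{α(k)}`, where `F̄^{α(-1)} = F^{α(0)}`. -/
def nodeFbar (η : ℝ) (X : ℕ → Conf d n) (α : A) : ℕ → ℝ
  | 0 => (1 - η) * P.nodeF ρ X α 0 + η * P.nodeF ρ X α 0
  | k + 1 => (1 - η) * nodeFbar η X α k + η * P.nodeF ρ X α (k + 1)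

/-- The averaged objective `F̄^{(k)}`, where `F̄^{(-1)} = F(X^{(0)})`. -/
def objectiveBar (η : ℝ) (X : ℕ → Conf d n) : ℕ → ℝ
  | 0 => (1 - η) * P.objective ρ (X 0) + η * P.objective ρ (X 0)
  | k + 1 => (1 - η) * objectiveBar η X k + η * P.objective ρ (X (k + 1))

end PoseGraph

/-! ### The algorithm -/

/-- The parameters of the method. -/
structure Params where
  η : ℝ
  ξ : ℝ
  ζ : ℝ
  φ : ℝ
  ψ : ℝ
  η_pos : 0 < η
  η_le_one : η ≤ 1
  ξ_nonneg : 0 ≤ ξ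
  ξ_le_ζ : ξ ≤ ζ
  φ_pos : 0 < φ
  φ_le_one : φ ≤ 1
  ψ_pos : 0 < ψ

/-- Nesterov's recursion `s ↦ (√(4 s² + 1) + 1) / 2`. -/
def nesterov (s : ℝ) : ℝ := (√(4 * s ^ 2 + 1) + 1) / 2

/-- `s'` is a possible value of `s^{α(k+1)}` at the start of iteration `k + 1` when there was a
restart in iteration `k`, which began with `s = s^{α(k)}` and `s^{α(k+1)} = nesterov s`. The halving
`s^{α(k)} ← max {s^{α(k)} / 2, 1}` comes after `s^{α(k+1)}` has been computed. All readings are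
admitted: it leaves `s^{α(k+1)}` as it is, or the halving applies to `s^{α(k+1)}`, or `s^{α(k+1)}`
is computed again from the halved value. -/
def IsRestartedMomentum (s s' : ℝ) : Prop :=
  s' = nesterov s ∨ s' = max (nesterov s / 2) 1 ∨ s' = nesterov (max (s / 2) 1)

/-- The extrapolated point `Y^{(k)}`, with `X^{(-1)} = X^{(0)}` (note `0 - 1 = 0` in `ℕ`). -/
def extrapolate (X : ℕ → Conf d n) (s : ℕ → A → ℝ) (k : ℕ) : Conf d n :=
  WithLp.toLp 2 fun α =>
    X k α + ((s k α - 1) / nesterov (s k α)) • (X k α - X (k - 1) α)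

/-- Iteration `k` of the method at the node `α`. The points `h₀`, `x₀`, `x₁` are the
intermediate values of `X^{α(k+½)}` and of `X^{α(k+1)}`: `h₀` and `x₀` are found from `Y^{(k)}`,
and `x₁` is the value of `X^{α(k+1)}` after the restart test. The points `x₀` and `x₁` are the
outcomes of an inexact minimization of `G^α(· | Y^{(k)})` and of `G^α(· | X^{(k)})` over `𝒳^α`
with `X^{α(k+½)}` as the initial guess. Any outcome in `𝒳^α` is allowed, so that every inexact
solver is covered. -/
def NodeStep (P : PoseGraph d n) (ρ : ℝ → ℝ) (p : Params) (X Xh : ℕ → Conf d n)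
    (s : ℕ → A → ℝ) (k : ℕ) (α : A) : Prop :=
  ∃ h₀ x₀ x₁ : NodeConf d (n α),
    let Y := extrapolate X s k
    let Fbar := P.nodeFbar ρ p.η X α k
    -- `x ↦ G^α(x | X^{(k)}) + F^{α(k)}`
    let G := fun x => P.nodeG ρ p.ξ (X k) (X k) α x + P.nodeF ρ X α k
    P.IsArgminH ρ p.ζ (X k) Y α h₀ ∧
    x₀ ∈ nodeFeasible d (n α) ∧
    (G h₀ > Fbar - p.ψ * ‖h₀ - X k α‖ ^ 2 → P.IsArgminH ρ p.ζ (X k) (X k) α (Xh k α)) ∧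
    (¬ G h₀ > Fbar - p.ψ * ‖h₀ - X k α‖ ^ 2 → Xh k α = h₀) ∧
    (G x₀ > Fbar → x₁ ∈ nodeFeasible d (n α) ∧ IsRestartedMomentum (s k α) (s (k + 1) α)) ∧
    (¬ G x₀ > Fbar → x₁ = x₀ ∧ s (k + 1) α = nesterov (s k α)) ∧
    (Fbar - G x₁ < p.φ * (Fbar - G (Xh k α)) → X (k + 1) α = Xh k α) ∧
    (¬ Fbar - G x₁ < p.φ * (Fbar - G (Xh k α)) → X (k + 1) α = x₁)

/-- `X k = X^{(k)}` and `Xh k = X^{(k+½)}` are sequences generated by the method. -/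
def IsRun (P : PoseGraph d n) (ρ : ℝ → ℝ) (p : Params) (X Xh : ℕ → Conf d n) : Prop :=
  X 0 ∈ feasible d n ∧
    ∃ s : ℕ → A → ℝ, (∀ α, s 0 α = 1) ∧ ∀ k α, NodeStep P ρ p X Xh s k α

/-! ### Riemannian gradient -/

/-- The tangent space of `𝒳` at `X ∈ 𝒳`: the translations are free and the matrix parts `V` satisfy
that `Rᵀ V` is skew-symmetric. -/
def tangentSpace (X : Conf d n) : Submodule ℝ (Conf d n) where
  carrier := {V | ∀ α i, ((rotat (X α i)).transpose * rotat (V α i)).transpose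
    = -((rotat (X α i)).transpose * rotat (V α i))}
  zero_mem' := by
    intro α i
    have h : rotat ((0 : Conf d n) α i) = 0 := rfl
    rw [h]; simp
  add_mem' := by
    intro V W hV hW α i
    have h : rotat ((V + W) α i) = rotat (V α i) + rotat (W α i) := rfl
    rw [h, mul_add, Matrix.transpose_add, hV α i, hW α i, neg_add]
  smul_mem' := by
    intro c V hV α i
    have h : rotat ((c • V) α i) = c • rotat (V α i) := rfl
    rw [h, Matrix.mul_smul, Matrix.transpose_smul, hV α i, smul_neg]

/-- The Riemannian gradient at `X ∈ 𝒳` of the restriction of `F` to the submanifold `𝒳` with the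
induced metric: the orthogonal projection of the Euclidean gradient to the tangent space. -/
def rgrad (F : Conf d n → ℝ) (X : Conf d n) : Conf d n :=
  (tangentSpace X).starProjection (gradient F X)

end

end DistPGO

open DistPGO

set_option linter.unusedSectionVars false
set_option autoImplicit false

/-! The method is a majorization-minimization scheme with safeguards, and every safeguard is checked
node by node. Three facts carry the descent. First, a concave kernel lies below its tangents, so
each `edgeF` is bounded above by a quadratic model with the form `weight * sqM`. The parallelogram
law replaces `sqM` by `sqOmega`, which decouples the two endpoints of an edge between nodes
(`edgeF_le_edgeE`). Second, the local values are exact in total: the gap between `pairE` and `pairF`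
is split evenly between the two nodes, hence `partF_add_partF` and `sum_nodeF`. Since that gap is
nonnegative, the local surrogate majorizes each local value, with `ξ / 2` times the squared step to
spare (`nodeF_succ_le`). Third, the tests of the algorithm force `NodeStep.descent` whatever the
inexact solver returns: the final point either is the safeguarded half step or achieves at least the
fraction `φ` of its decrease.

By induction each local value stays below its running average, and averaging costs only a factor
`η`; summed over the nodes this is `objectiveBar_decrease`. Monotonicity and nonnegativity give the
limit of the averages, the recursion transfers it to the objective, and telescoping makes the
squared steps summable.

For the gradients, the half step always minimizes `nodeH` exactly, at a base point no farther from
the current iterate than the previous step, because the momentum factor lies in `[0, 1]`.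
Stationarity along curves in the rotation group, together with a Lipschitz Euclidean gradient,
bounds the Riemannian gradient at the half step by two consecutive displacements
(`exists_norm_rgrad_half_le`). Summing squares gives the rate. Transporting tangent vectors between
nearby feasible points (`norm_rgrad_le`) carries the limit over to the iterates themselves. -/

namespace DistPGO

noncomputable section

/-! ### Poses -/

/-- The pose `[t R]`. -/
def mkPose {d : ℕ} (t : Fin d → ℝ) (R : Matrix (Fin d) (Fin d) ℝ) : Pose d :=
  WithLp.toLp 2 fun p => (Fin.cons (t p.1) (R p.1) : Fin (d + 1) → ℝ) p.2

@[simp] lemma transl_mkPose {d : ℕ} (t : Fin d → ℝ) (R : Matrix (Fin d) (Fin d) ℝ) :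
    transl (mkPose t R) = t := rfl

@[simp] lemma rotat_mkPose {d : ℕ} (t : Fin d → ℝ) (R : Matrix (Fin d) (Fin d) ℝ) :
    rotat (mkPose t R) = R := rfl

@[simp] lemma mkPose_transl_rotat {d : ℕ} (x : Pose d) : mkPose (transl x) (rotat x) = x := by
  ext ⟨a, b⟩
  refine Fin.cases rfl (fun b => rfl) b

lemma mkPose_add {d : ℕ} (t t' : Fin d → ℝ) (R R' : Matrix (Fin d) (Fin d) ℝ) :
    mkPose (t + t') (R + R') = mkPose t R + mkPose t' R' := by
  ext ⟨a, b⟩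
  refine Fin.cases rfl (fun b => rfl) b

lemma mkPose_smul {d : ℕ} (c : ℝ) (t : Fin d → ℝ) (R : Matrix (Fin d) (Fin d) ℝ) :
    mkPose (c • t) (c • R) = c • mkPose t R := by
  ext ⟨a, b⟩
  refine Fin.cases rfl (fun b => rfl) b

lemma mkPose_sub {d : ℕ} (t t' : Fin d → ℝ) (R R' : Matrix (Fin d) (Fin d) ℝ) :
    mkPose (t - t') (R - R') = mkPose t R - mkPose t' R' := by
  ext ⟨a, b⟩
  refine Fin.cases rfl (fun b => rfl) b

@[simp] lemma transl_add {d : ℕ} (x y : Pose d) : transl (x + y) = transl x + transl y := rfl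
@[simp] lemma rotat_add {d : ℕ} (x y : Pose d) : rotat (x + y) = rotat x + rotat y := rfl
@[simp] lemma transl_sub {d : ℕ} (x y : Pose d) : transl (x - y) = transl x - transl y := rfl
@[simp] lemma rotat_sub {d : ℕ} (x y : Pose d) : rotat (x - y) = rotat x - rotat y := rfl
@[simp] lemma transl_smul {d : ℕ} (c : ℝ) (x : Pose d) : transl (c • x) = c • transl x := rfl
@[simp] lemma rotat_smul {d : ℕ} (c : ℝ) (x : Pose d) : rotat (c • x) = c • rotat x := rfl

lemma frobSq_eq_sum {d : ℕ} (M : Matrix (Fin d) (Fin d) ℝ) :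
    frobSq M = ∑ a, ∑ b, M a b ^ 2 := by
  simp [frobSq, Matrix.trace, Matrix.mul_apply, sq]

lemma frobSq_nonneg {d : ℕ} (M : Matrix (Fin d) (Fin d) ℝ) : 0 ≤ frobSq M := by
  rw [frobSq_eq_sum]; positivity

lemma vecSq_nonneg {d : ℕ} (v : Fin d → ℝ) : 0 ≤ vecSq v := by
  simp only [vecSq, dotProduct]
  exact Finset.sum_nonneg fun i _ => mul_self_nonneg _

lemma norm_sq_pose {d : ℕ} (x : Pose d) :
    ‖x‖ ^ 2 = vecSq (transl x) + frobSq (rotat x) := by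
  rw [EuclideanSpace.norm_sq_eq, Fintype.sum_prod_type, frobSq_eq_sum, vecSq, dotProduct,
    ← Finset.sum_add_distrib]
  refine Finset.sum_congr rfl fun a _ => ?_
  rw [Fin.sum_univ_succ]
  simp [transl, rotat, sq]

lemma frobSq_smul {d : ℕ} (c : ℝ) (M : Matrix (Fin d) (Fin d) ℝ) :
    frobSq (c • M) = c ^ 2 * frobSq M := by
  simp only [frobSq_eq_sum, Matrix.smul_apply, smul_eq_mul, mul_pow, Finset.mul_sum]

lemma vecSq_smul {d : ℕ} (c : ℝ) (v : Fin d → ℝ) : vecSq (c • v) = c ^ 2 * vecSq v := by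
  simp [vecSq]; ring

lemma frobSq_mul_le {d : ℕ} (M N : Matrix (Fin d) (Fin d) ℝ) :
    frobSq (M * N) ≤ frobSq M * frobSq N := by
  have hN : frobSq N = ∑ b, ∑ a, N a b ^ 2 := by rw [frobSq_eq_sum, Finset.sum_comm]
  rw [frobSq_eq_sum, frobSq_eq_sum M, hN, Finset.sum_mul_sum]
  refine Finset.sum_le_sum fun a _ => Finset.sum_le_sum fun b _ => ?_
  rw [Matrix.mul_apply]
  exact Finset.sum_mul_sq_le_sq_mul_sq _ _ _

lemma frobSq_transpose {d : ℕ} (M : Matrix (Fin d) (Fin d) ℝ) :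
    frobSq M.transpose = frobSq M := by
  rw [frobSq_eq_sum, frobSq_eq_sum, Finset.sum_comm]; rfl

lemma mul_transpose_of_mem_SO {d : ℕ} {Q : Matrix (Fin d) (Fin d) ℝ}
    (hQ : Q ∈ Matrix.specialOrthogonalGroup (Fin d) ℝ) : Q * Q.transpose = 1 :=
  Matrix.mem_orthogonalGroup_iff (Fin d) ℝ |>.1 (Matrix.mem_specialOrthogonalGroup_iff.1 hQ).1

lemma transpose_mul_of_mem_SO {d : ℕ} {Q : Matrix (Fin d) (Fin d) ℝ}
    (hQ : Q ∈ Matrix.specialOrthogonalGroup (Fin d) ℝ) : Q.transpose * Q = 1 :=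
  Matrix.mem_orthogonalGroup_iff' (Fin d) ℝ |>.1 (Matrix.mem_specialOrthogonalGroup_iff.1 hQ).1

lemma frobSq_mul_SO {d : ℕ} (M : Matrix (Fin d) (Fin d) ℝ) {Q : Matrix (Fin d) (Fin d) ℝ}
    (hQ : Q ∈ Matrix.specialOrthogonalGroup (Fin d) ℝ) : frobSq (M * Q) = frobSq M := by
  rw [frobSq, Matrix.transpose_mul, Matrix.mul_assoc, ← Matrix.mul_assoc Q,
    mul_transpose_of_mem_SO hQ, Matrix.one_mul, frobSq]

lemma frobSq_SO_transpose_mul {d : ℕ} (M : Matrix (Fin d) (Fin d) ℝ)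
    {Q : Matrix (Fin d) (Fin d) ℝ} (hQ : Q ∈ Matrix.specialOrthogonalGroup (Fin d) ℝ) :
    frobSq (Q.transpose * M) = frobSq M := by
  rw [← frobSq_transpose, Matrix.transpose_mul, Matrix.transpose_transpose, frobSq_mul_SO _ hQ,
    frobSq_transpose]

/-! ### The linear maps of an edge -/

open PoseGraph

variable {A : Type*} [Fintype A] [DecidableEq A] {d : ℕ} {n : A → ℕ}

@[simp] lemma poseAt_add (X Y : Conf d n) (v : Vertex n) :
    poseAt (X + Y) v = poseAt X v + poseAt Y v := rfl
@[simp] lemma poseAt_smul (c : ℝ) (X : Conf d n) (v : Vertex n) :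
    poseAt (c • X) v = c • poseAt X v := rfl

@[simp] lemma embed_apply_self (α : A) (x : NodeConf d (n α)) :
    (embed (n := n) α x) α = x := by
  simp [embed]

lemma embed_apply_of_ne {α β : A} (h : β ≠ α) (x : NodeConf d (n α)) :
    (embed (n := n) α x) β = 0 := by
  simp [embed, h]

lemma embed_add (α : A) (x y : NodeConf d (n α)) :
    (embed α (x + y) : Conf d n) = embed α x + embed α y := by
  simp [embed, Pi.single_add]

lemma embed_sub (α : A) (x y : NodeConf d (n α)) :
    (embed α (x - y) : Conf d n) = embed α x - embed α y := by
  simp [embed, Pi.single_sub]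

lemma embed_smul (α : A) (c : ℝ) (x : NodeConf d (n α)) :
    (embed α (c • x) : Conf d n) = c • embed α x := by
  simp [embed, Pi.single_smul]

lemma inner_eq_sum_node (X Y : Conf d n) : inner ℝ X Y = ∑ α, inner ℝ (X α) (Y α) :=
  PiLp.inner_apply X Y

lemma inner_embed (X : Conf d n) (α : A) (y : NodeConf d (n α)) :
    inner ℝ X (embed α y) = inner ℝ (X α) y := by
  rw [inner_eq_sum_node, Finset.sum_eq_single α, embed_apply_self]
  · intro β _ hβ
    rw [embed_apply_of_ne hβ, inner_zero_right]
  · simp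

lemma norm_embed (α : A) (x : NodeConf d (n α)) : ‖(embed α x : Conf d n)‖ = ‖x‖ := by
  rw [← sq_eq_sq₀ (norm_nonneg _) (norm_nonneg _), ← real_inner_self_eq_norm_sq,
    ← real_inner_self_eq_norm_sq, inner_embed, embed_apply_self]

lemma norm_sq_eq_sum_node (X : Conf d n) : ‖X‖ ^ 2 = ∑ α, ‖X α‖ ^ 2 :=
  PiLp.norm_sq_eq_of_L2 _ X

lemma norm_node_le (X : Conf d n) (α : A) : ‖X α‖ ≤ ‖X‖ := PiLp.norm_apply_le X α

namespace PoseGraph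

variable (P : PoseGraph d n)

/-- The block `[√τ (R t̃ + t)  √κ R R̃]` of the tail vertex of an edge. -/
def headMap (e : Vertex n × Vertex n) : Conf d n →L[ℝ] Pose d :=
  LinearMap.toContinuousLinearMap
    { toFun := fun X => mkPose
        (√(P.τ e) • ((rotat (poseAt X e.1)).mulVec (P.measT e) + transl (poseAt X e.1)))
        (√(P.κ e) • (rotat (poseAt X e.1) * (P.measR e : Matrix (Fin d) (Fin d) ℝ)))
      map_add' := fun X Y => by
        rw [← mkPose_add]
        simp only [poseAt_add, rotat_add, transl_add, Matrix.add_mulVec, Matrix.add_mul]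
        congr 1
        · rw [← smul_add]; congr 1; abel
        · rw [smul_add]
      map_smul' := fun c X => by
        rw [RingHom.id_apply, ← mkPose_smul]
        simp only [poseAt_smul, rotat_smul, transl_smul, Matrix.smul_mulVec, Matrix.smul_mul]
        congr 1
        · rw [← smul_add, smul_comm]
        · rw [smul_comm] }

/-- The block `[√τ t  √κ R]` of the second vertex of an edge. -/
def tailMap (e : Vertex n × Vertex n) : Conf d n →L[ℝ] Pose d :=
  LinearMap.toContinuousLinearMap
    { toFun := fun X => mkPose (√(P.τ e) • transl (poseAt X e.2)) (√(P.κ e) • rotat (poseAt X e.2))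
      map_add' := fun X Y => by
        rw [← mkPose_add]
        simp only [poseAt_add, rotat_add, transl_add, smul_add]
      map_smul' := fun c X => by
        rw [RingHom.id_apply, ← mkPose_smul]
        simp only [poseAt_smul, rotat_smul, transl_smul]
        congr 1
        · rw [smul_comm]
        · rw [smul_comm] }

/-- The linear map whose squared norm is `‖·‖²` for `M_ij^{αβ}`. -/
def edgeMap (e : Vertex n × Vertex n) : Conf d n →L[ℝ] Pose d := P.headMap e - P.tailMap e

lemma headMap_apply (e : Vertex n × Vertex n) (X : Conf d n) : P.headMap e X = mkPose
    (√(P.τ e) • ((rotat (poseAt X e.1)).mulVec (P.measT e) + transl (poseAt X e.1)))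
    (√(P.κ e) • (rotat (poseAt X e.1) * (P.measR e : Matrix (Fin d) (Fin d) ℝ))) := rfl

lemma tailMap_apply (e : Vertex n × Vertex n) (X : Conf d n) : P.tailMap e X =
    mkPose (√(P.τ e) • transl (poseAt X e.2)) (√(P.κ e) • rotat (poseAt X e.2)) := rfl

lemma edgeMap_apply (e : Vertex n × Vertex n) (X : Conf d n) :
    P.edgeMap e X = P.headMap e X - P.tailMap e X := rfl

lemma sqM_eq {e : Vertex n × Vertex n} (he : e ∈ P.edges) (X : Conf d n) :
    P.sqM e X = ‖P.edgeMap e X‖ ^ 2 := by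
  rw [edgeMap_apply, headMap_apply, tailMap_apply, ← mkPose_sub, norm_sq_pose, transl_mkPose,
    rotat_mkPose, ← smul_sub, ← smul_sub, vecSq_smul, frobSq_smul,
    Real.sq_sqrt (P.κ_nonneg e he), Real.sq_sqrt (P.τ_nonneg e he), sqM]
  ring

/-- Right multiplication by the orthogonal measurement preserves the Frobenius norm. Hence the two
maps whose difference gives `sqM` also give `sqOmega`, and the comparison of the two forms becomes a
statement about two vectors. -/
lemma sqOmega_eq {e : Vertex n × Vertex n} (he : e ∈ P.edges) (X : Conf d n) :
    P.sqOmega e X = 2 * (‖P.headMap e X‖ ^ 2 + ‖P.tailMap e X‖ ^ 2) := by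
  rw [headMap_apply, tailMap_apply, norm_sq_pose, norm_sq_pose, transl_mkPose,
    rotat_mkPose, transl_mkPose, rotat_mkPose, vecSq_smul, frobSq_smul, vecSq_smul, frobSq_smul,
    frobSq_mul_SO _ (P.measR e).2,
    Real.sq_sqrt (P.κ_nonneg e he), Real.sq_sqrt (P.τ_nonneg e he), sqOmega]
  ring

lemma sqM_nonneg {e : Vertex n × Vertex n} (he : e ∈ P.edges) (X : Conf d n) : 0 ≤ P.sqM e X := by
  rw [P.sqM_eq he]; positivity

/-- This is `‖a - b‖² ≤ 2 ‖a‖² + 2 ‖b‖²`; dropping the cross term is what allows the nodes to be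
treated separately. -/
lemma sqM_le_sqOmega {e : Vertex n × Vertex n} (he : e ∈ P.edges) (X : Conf d n) :
    P.sqM e X ≤ P.sqOmega e X := by
  rw [P.sqM_eq he, P.sqOmega_eq he, edgeMap_apply]
  have := parallelogram_law_with_norm ℝ (P.headMap e X) (P.tailMap e X)
  nlinarith [sq_nonneg ‖P.headMap e X + P.tailMap e X‖]

lemma headMap_congr (e : Vertex n × Vertex n) {X Y : Conf d n} (h : X e.1.1 = Y e.1.1) :
    P.headMap e X = P.headMap e Y := by
  simp only [headMap_apply, poseAt, h]

lemma tailMap_congr (e : Vertex n × Vertex n) {X Y : Conf d n} (h : X e.2.1 = Y e.2.1) :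
    P.tailMap e X = P.tailMap e Y := by
  simp only [tailMap_apply, poseAt, h]

lemma headMap_embed_of_ne {e : Vertex n × Vertex n} {α : A} (h : e.1.1 ≠ α)
    (x : NodeConf d (n α)) : P.headMap e (embed α x) = 0 := by
  rw [P.headMap_congr e (Y := 0) (embed_apply_of_ne h x), map_zero]

lemma tailMap_embed_of_ne {e : Vertex n × Vertex n} {α : A} (h : e.2.1 ≠ α)
    (x : NodeConf d (n α)) : P.tailMap e (embed α x) = 0 := by
  rw [P.tailMap_congr e (Y := 0) (embed_apply_of_ne h x), map_zero]

lemma sqOmega_embed_of_ne {e : Vertex n × Vertex n} (he : e ∈ P.edges) {α : A} (h : e.1.1 ≠ α)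
    (h' : e.2.1 ≠ α) (x : NodeConf d (n α)) : P.sqOmega e (embed α x) = 0 := by
  simp [P.sqOmega_eq he, P.headMap_embed_of_ne h, P.tailMap_embed_of_ne h']

lemma edgeMap_embed_of_ne {e : Vertex n × Vertex n} {α : A} (h : e.1.1 ≠ α)
    (h' : e.2.1 ≠ α) (x : NodeConf d (n α)) : P.edgeMap e (embed α x) = 0 := by
  simp [edgeMap_apply, P.headMap_embed_of_ne h, P.tailMap_embed_of_ne h']

lemma sqM_embed_of_ne {e : Vertex n × Vertex n} (he : e ∈ P.edges) {α : A} (h : e.1.1 ≠ α)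
    (h' : e.2.1 ≠ α) (x : NodeConf d (n α)) : P.sqM e (embed α x) = 0 := by
  simp [P.sqM_eq he, P.edgeMap_embed_of_ne h h']

/-- For an edge between different nodes, `Ω` is block diagonal. -/
lemma sqOmega_eq_add_embed {e : Vertex n × Vertex n} (he : e ∈ P.edges) (hne : e.1.1 ≠ e.2.1)
    (X : Conf d n) : P.sqOmega e X
      = P.sqOmega e (embed e.1.1 (X e.1.1)) + P.sqOmega e (embed e.2.1 (X e.2.1)) := by
  rw [P.sqOmega_eq he, P.sqOmega_eq he, P.sqOmega_eq he, P.headMap_embed_of_ne hne,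
    P.tailMap_embed_of_ne hne.symm,
    P.headMap_congr e (X := X) (Y := embed e.1.1 (X e.1.1)) (by simp),
    P.tailMap_congr e (X := X) (Y := embed e.2.1 (X e.2.1)) (by simp)]
  simp
  ring

lemma sqM_eq_embed {e : Vertex n × Vertex n} (he : e ∈ P.edges) (heq : e.1.1 = e.2.1)
    (X : Conf d n) : P.sqM e X = P.sqM e (embed e.1.1 (X e.1.1)) := by
  rw [P.sqM_eq he, P.sqM_eq he, edgeMap_apply, edgeMap_apply,
    P.headMap_congr e (X := X) (Y := embed e.1.1 (X e.1.1)) (by simp),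
    P.tailMap_congr e (X := X) (Y := embed e.1.1 (X e.1.1)) (by rw [← heq]; simp)]

end PoseGraph

/-! ### Consequences of the kernel axioms -/

namespace IsLossKernel

variable {ρ : ℝ → ℝ}

lemma hasDerivWithinAt (hρ : IsLossKernel ρ) {s : ℝ} (hs : 0 ≤ s) :
    HasDerivWithinAt ρ (derivWithin ρ (Set.Ici 0) s) (Set.Ici 0) s :=
  (hρ.contDiffOn.differentiableOn one_ne_zero s hs).hasDerivWithinAt

/-- A concave function lies below its tangents. -/
lemma le_tangent (hρ : IsLossKernel ρ) {s t : ℝ} (hs : 0 ≤ s) (ht : 0 ≤ t) :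
    ρ t ≤ ρ s + derivWithin ρ (Set.Ici 0) s * (t - s) := by
  have hd := hρ.hasDerivWithinAt hs
  rcases lt_trichotomy s t with h | h | h
  · have := hρ.concaveOn.slope_le_of_hasDerivWithinAt hs ht h hd
    rw [slope_def_field, div_le_iff₀ (by linarith)] at this
    linarith
  · subst h; simp
  · have := hρ.concaveOn.le_slope_of_hasDerivWithinAt ht hs h hd
    rw [slope_def_field, le_div_iff₀ (by linarith)] at this
    linarith

/-- The squared norm never leaves `[0, ∞)`, so the derivative of `ρ` within that half-line suffices
for a full Fréchet derivative, even where the norm vanishes. -/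
lemma hasFDerivAt_comp_norm_sq (hρ : IsLossKernel ρ) {E F : Type*} [NormedAddCommGroup E]
    [NormedSpace ℝ E] [NormedAddCommGroup F] [InnerProductSpace ℝ F] (L : E →L[ℝ] F) (Z : E) :
    HasFDerivAt (fun X => ρ (‖L X‖ ^ 2))
      (derivWithin ρ (Set.Ici 0) (‖L Z‖ ^ 2) • ((2 : ℕ) • (innerSL ℝ (L Z)).comp L)) Z :=
  (hρ.hasDerivWithinAt (sq_nonneg ‖L Z‖)).comp_hasFDerivAt Z (f := fun X => ‖L X‖ ^ 2)
    L.hasFDerivAt.norm_sq (Eventually.of_forall fun X => sq_nonneg ‖L X‖)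

lemma inner_gradient_norm_sq (hρ : IsLossKernel ρ) {F : Type*} [NormedAddCommGroup F]
    [InnerProductSpace ℝ F] [CompleteSpace F] (Z h : F) :
    inner ℝ (gradient (fun Z : F => ρ (‖Z‖ ^ 2)) Z) h
      = 2 * derivWithin ρ (Set.Ici 0) (‖Z‖ ^ 2) * inner ℝ Z h := by
  have := hρ.hasFDerivAt_comp_norm_sq (ContinuousLinearMap.id ℝ F) Z
  simp only [ContinuousLinearMap.id_apply] at this
  rw [gradient, InnerProductSpace.toDual_symm_apply, this.fderiv]
  simp
  ring

end IsLossKernel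

lemma inner_gradient {F : Type*} [NormedAddCommGroup F] [InnerProductSpace ℝ F] [CompleteSpace F]
    (f : F → ℝ) (x h : F) : inner ℝ (gradient f x) h = fderiv ℝ f x h := by
  rw [gradient, InnerProductSpace.toDual_symm_apply]

lemma gradient_sum {ι F : Type*} [NormedAddCommGroup F] [InnerProductSpace ℝ F] [CompleteSpace F]
    (s : Finset ι) (f : ι → F → ℝ) (x : F) (h : ∀ i ∈ s, DifferentiableAt ℝ (f i) x) :
    gradient (fun y => ∑ i ∈ s, f i y) x = ∑ i ∈ s, gradient (f i) x := by
  simp only [gradient, fderiv_fun_sum h, map_sum]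

namespace PoseGraph

variable (P : PoseGraph d n) {ρ : ℝ → ℝ}

lemma weight_nonneg (hρ : IsLossKernel ρ) {e : Vertex n × Vertex n} (he : e ∈ P.edges)
    (X : Conf d n) : 0 ≤ P.weight ρ e X := by
  unfold weight
  split_ifs
  · exact zero_le_one
  · exact hρ.deriv_nonneg _ (P.sqM_nonneg he X)

lemma weight_le_one (hρ : IsLossKernel ρ) {e : Vertex n × Vertex n} (he : e ∈ P.edges)
    (X : Conf d n) : P.weight ρ e X ≤ 1 := by
  unfold weight
  split_ifs
  · exact le_rfl
  · exact hρ.deriv_le_one _ (P.sqM_nonneg he X)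

lemma edgeF_nonneg (hρ : IsLossKernel ρ) {e : Vertex n × Vertex n} (he : e ∈ P.edges)
    (X : Conf d n) : 0 ≤ P.edgeF ρ e X := by
  have h := P.sqM_nonneg he X
  have h' := hρ.nonneg _ h
  unfold edgeF
  split_ifs <;> positivity

lemma objective_nonneg (hρ : IsLossKernel ρ) (X : Conf d n) : 0 ≤ P.objective ρ X :=
  Finset.sum_nonneg fun _ he => P.edgeF_nonneg hρ he X

lemma hasFDerivAt_edgeF (hρ : IsLossKernel ρ) {e : Vertex n × Vertex n} (he : e ∈ P.edges)
    (Z : Conf d n) : HasFDerivAt (P.edgeF ρ e)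
      (P.weight ρ e Z • (innerSL ℝ (P.edgeMap e Z)).comp (P.edgeMap e)) Z := by
  by_cases heq : e.1.1 = e.2.1
  · have h1 : P.edgeF ρ e = fun X => 1 / 2 * ‖P.edgeMap e X‖ ^ 2 := by
      funext X; rw [edgeF, if_pos heq, P.sqM_eq he]
    rw [h1, weight, if_pos heq]
    refine ((P.edgeMap e).hasFDerivAt.norm_sq.const_mul (1 / 2)).congr_fderiv ?_
    ext1 h
    simp
  · have h1 : P.edgeF ρ e = fun X => 1 / 2 * ρ (‖P.edgeMap e X‖ ^ 2) := by
      funext X; rw [edgeF, if_neg heq, P.sqM_eq he]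
    rw [h1, weight, if_neg heq, P.sqM_eq he]
    refine ((hρ.hasFDerivAt_comp_norm_sq (P.edgeMap e) Z).const_mul (1 / 2)).congr_fderiv ?_
    ext1 h
    simp
    ring

lemma differentiableAt_edgeF (hρ : IsLossKernel ρ) {e : Vertex n × Vertex n} (he : e ∈ P.edges)
    (Z : Conf d n) : DifferentiableAt ℝ (P.edgeF ρ e) Z :=
  (P.hasFDerivAt_edgeF hρ he Z).differentiableAt

lemma inner_gradient_edgeF (hρ : IsLossKernel ρ) {e : Vertex n × Vertex n} (he : e ∈ P.edges)
    (Z h : Conf d n) : inner ℝ (gradient (P.edgeF ρ e) Z) h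
      = P.weight ρ e Z * inner ℝ (P.edgeMap e Z) (P.edgeMap e h) := by
  rw [inner_gradient, (P.hasFDerivAt_edgeF hρ he Z).fderiv]
  simp

lemma gradient_objective (hρ : IsLossKernel ρ) (Z : Conf d n) :
    gradient (P.objective ρ) Z = ∑ e ∈ P.edges, gradient (P.edgeF ρ e) Z :=
  gradient_sum _ _ _ fun _ he => P.differentiableAt_edgeF hρ he Z

lemma norm_sq_edgeMap_expand (e : Vertex n × Vertex n) (X Z : Conf d n) :
    ‖P.edgeMap e X‖ ^ 2 = ‖P.edgeMap e Z‖ ^ 2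
      + 2 * inner ℝ (P.edgeMap e Z) (P.edgeMap e (X - Z)) + ‖P.edgeMap e (X - Z)‖ ^ 2 := by
  rw [← norm_add_sq_real, ← map_add]
  congr 3
  abel

/-- Inside a node, `F_ij` is quadratic. -/
lemma edgeF_expand (hρ : IsLossKernel ρ) {e : Vertex n × Vertex n} (he : e ∈ P.edges)
    (heq : e.1.1 = e.2.1) (X Z : Conf d n) : P.edgeF ρ e X
      = P.edgeF ρ e Z + inner ℝ (gradient (P.edgeF ρ e) Z) (X - Z) + 1 / 2 * P.sqM e (X - Z) := by
  rw [P.inner_gradient_edgeF hρ he, weight, if_pos heq, edgeF, if_pos heq, edgeF, if_pos heq,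
    P.sqM_eq he, P.sqM_eq he, P.sqM_eq he, P.norm_sq_edgeMap_expand e X Z]
  ring

/-- Inserting the exact quadratic expansion of `sqM` about `Z` into the tangent bound for `ρ`
produces precisely the gradient term plus the weighted form. -/
lemma edgeF_le (hρ : IsLossKernel ρ) {e : Vertex n × Vertex n} (he : e ∈ P.edges)
    (X Z : Conf d n) : P.edgeF ρ e X ≤ P.edgeF ρ e Z + inner ℝ (gradient (P.edgeF ρ e) Z) (X - Z)
      + 1 / 2 * P.weight ρ e Z * P.sqM e (X - Z) := by
  by_cases heq : e.1.1 = e.2.1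
  · rw [P.edgeF_expand hρ he heq X Z, weight, if_pos heq, mul_one]
  · have h := hρ.le_tangent (P.sqM_nonneg he Z) (P.sqM_nonneg he X)
    rw [P.inner_gradient_edgeF hρ he, weight, if_neg heq, edgeF, if_neg heq, edgeF, if_neg heq]
    rw [P.sqM_eq he X, P.norm_sq_edgeMap_expand e X Z, ← P.sqM_eq he, ← P.sqM_eq he] at h
    rw [P.sqM_eq he X, P.norm_sq_edgeMap_expand e X Z, ← P.sqM_eq he, ← P.sqM_eq he]
    linarith

lemma edgeF_le_edgeE (hρ : IsLossKernel ρ) {e : Vertex n × Vertex n} (he : e ∈ P.edges)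
    (X Z : Conf d n) : P.edgeF ρ e X ≤ P.edgeE ρ e X Z := by
  have h := P.edgeF_le hρ he X Z
  have h' := mul_le_mul_of_nonneg_left (P.sqM_le_sqOmega he (X - Z)) (P.weight_nonneg hρ he Z)
  rw [edgeE]
  linarith

/-! ### Lipschitz gradients -/

/-- Between nodes, the gradient is half the pull-back along `edgeMap` of the gradient of `W ↦ ρ (‖W‖
^ 2)` on poses, which is Lipschitz by the kernel axiom for `d × (d + 1)` matrices. -/
lemma exists_lipschitz_gradient_edgeF (hρ : IsLossKernel ρ) {e : Vertex n × Vertex n}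
    (he : e ∈ P.edges) : ∃ C : ℝ, 0 ≤ C ∧ ∀ X Y : Conf d n,
      ‖gradient (P.edgeF ρ e) X - gradient (P.edgeF ρ e) Y‖ ≤ C * ‖X - Y‖ := by
  generalize hL : P.edgeMap e = L
  obtain ⟨μ, hμ, hlip⟩ : ∃ μ : ℝ, 0 < μ ∧ ∀ X Y h : Conf d n,
      inner ℝ (gradient (P.edgeF ρ e) X - gradient (P.edgeF ρ e) Y) h
        ≤ μ * ‖L (X - Y)‖ * ‖L h‖ := by
    by_cases heq : e.1.1 = e.2.1
    · refine ⟨1, one_pos, fun X Y h => ?_⟩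
      rw [inner_sub_left, P.inner_gradient_edgeF hρ he, P.inner_gradient_edgeF hρ he, weight,
        hL, if_pos heq, weight, if_pos heq, one_mul, one_mul, one_mul, ← inner_sub_left, ← map_sub]
      exact real_inner_le_norm _ _
    · obtain ⟨μ, hμ, hg⟩ := hρ.lipschitz_gradient d (d + 1)
      refine ⟨μ, hμ, fun X Y h => ?_⟩
      have key : ∀ Z : Conf d n, inner ℝ (gradient (P.edgeF ρ e) Z) h
          = 1 / 2 * inner ℝ (gradient (fun W : Pose d => ρ (‖W‖ ^ 2)) (L Z)) (L h) := by
        intro Z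
        rw [P.inner_gradient_edgeF hρ he, hρ.inner_gradient_norm_sq, weight, if_neg heq,
          P.sqM_eq he, hL]
        ring
      rw [inner_sub_left, key, key, ← mul_sub, ← inner_sub_left]
      have h1 := real_inner_le_norm (gradient (fun W : Pose d => ρ (‖W‖ ^ 2)) (L X)
        - gradient (fun W : Pose d => ρ (‖W‖ ^ 2)) (L Y)) (L h)
      have h2 := mul_le_mul_of_nonneg_right (hg (L X) (L Y)) (norm_nonneg (L h))
      rw [← map_sub] at h2
      have h3 : 0 ≤ μ * ‖L (X - Y)‖ * ‖L h‖ := by positivity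
      linarith
  refine ⟨μ * ‖L‖ * ‖L‖, by positivity, fun X Y => ?_⟩
  -- The weak estimate is tested against the gradient difference itself, and one factor of its norm
  -- is then cancelled.
  generalize hD : gradient (P.edgeF ρ e) X - gradient (P.edgeF ρ e) Y = D
  have h1 := hlip X Y D
  rw [hD, real_inner_self_eq_norm_sq] at h1
  have h2 : μ * ‖L (X - Y)‖ * ‖L D‖ ≤ μ * (‖L‖ * ‖X - Y‖) * (‖L‖ * ‖D‖) :=
    mul_le_mul (mul_le_mul_of_nonneg_left (L.le_opNorm _) hμ.le) (L.le_opNorm _) (norm_nonneg _)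
      (by positivity)
  rcases (norm_nonneg D).eq_or_lt with h0 | h0
  · rw [← h0]; exact mul_nonneg (by positivity) (norm_nonneg _)
  · refine le_of_mul_le_mul_right ?_ h0
    calc ‖D‖ * ‖D‖ = ‖D‖ ^ 2 := by ring
      _ ≤ μ * (‖L‖ * ‖X - Y‖) * (‖L‖ * ‖D‖) := h1.trans h2
      _ = _ := by ring

lemma exists_lipschitz_gradient_objective (hρ : IsLossKernel ρ) :
    ∃ C : ℝ, 0 ≤ C ∧ ∀ X Y : Conf d n,
      ‖gradient (P.objective ρ) X - gradient (P.objective ρ) Y‖ ≤ C * ‖X - Y‖ := by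
  have h : ∀ e : Vertex n × Vertex n, ∃ C : ℝ, 0 ≤ C ∧ (e ∈ P.edges → ∀ X Y : Conf d n,
      ‖gradient (P.edgeF ρ e) X - gradient (P.edgeF ρ e) Y‖ ≤ C * ‖X - Y‖) := by
    intro e
    by_cases he : e ∈ P.edges
    · obtain ⟨C, hC, hC'⟩ := P.exists_lipschitz_gradient_edgeF hρ he
      exact ⟨C, hC, fun _ => hC'⟩
    · exact ⟨0, le_rfl, fun h => absurd h he⟩
  choose C hC hC' using h
  refine ⟨∑ e ∈ P.edges, C e, Finset.sum_nonneg fun e _ => hC e, fun X Y => ?_⟩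
  rw [P.gradient_objective hρ, P.gradient_objective hρ, ← Finset.sum_sub_distrib, Finset.sum_mul]
  exact norm_sum_le_of_le _ fun e he => hC' e he X Y

/-! ### Bounds for the quadratic forms -/

/-- The bilinear form of `Ω_ij^{αβ}`. -/
def bilinOmega (e : Vertex n × Vertex n) (X Y : Conf d n) : ℝ :=
  2 * (inner ℝ (P.headMap e X) (P.headMap e Y) + inner ℝ (P.tailMap e X) (P.tailMap e Y))

lemma sqOmega_add {e : Vertex n × Vertex n} (he : e ∈ P.edges) (X Y : Conf d n) :
    P.sqOmega e (X + Y) = P.sqOmega e X + 2 * P.bilinOmega e X Y + P.sqOmega e Y := by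
  rw [P.sqOmega_eq he, P.sqOmega_eq he, P.sqOmega_eq he, map_add, map_add, norm_add_sq_real,
    norm_add_sq_real, bilinOmega]
  ring

/-- A common bound for the bilinear forms of all `Ω_ij^{αβ}`. -/
def omegaBound : ℝ := ∑ e ∈ P.edges, 2 * (‖P.headMap e‖ ^ 2 + ‖P.tailMap e‖ ^ 2)

lemma omegaBound_nonneg : 0 ≤ P.omegaBound := by unfold omegaBound; positivity

lemma abs_bilinOmega_le (e : Vertex n × Vertex n) (X Y : Conf d n) :
    |P.bilinOmega e X Y| ≤ 2 * (‖P.headMap e‖ ^ 2 + ‖P.tailMap e‖ ^ 2) * (‖X‖ * ‖Y‖) := by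
  have h : ∀ L : Conf d n →L[ℝ] Pose d, |inner ℝ (L X) (L Y)| ≤ ‖L‖ ^ 2 * (‖X‖ * ‖Y‖) := by
    intro L
    refine (abs_real_inner_le_norm _ _).trans ?_
    calc ‖L X‖ * ‖L Y‖ ≤ (‖L‖ * ‖X‖) * (‖L‖ * ‖Y‖) := by
          gcongr <;> exact L.le_opNorm _
      _ = _ := by ring
  rw [bilinOmega, abs_mul, abs_two]
  have := abs_add_le (inner ℝ (P.headMap e X) (P.headMap e Y))
    (inner ℝ (P.tailMap e X) (P.tailMap e Y))
  have h1 := h (P.headMap e)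
  have h2 := h (P.tailMap e)
  linarith

lemma sqOmega_eq_bilinOmega {e : Vertex n × Vertex n} (he : e ∈ P.edges) (X : Conf d n) :
    P.sqOmega e X = P.bilinOmega e X X := by
  rw [P.sqOmega_eq he, bilinOmega, real_inner_self_eq_norm_sq, real_inner_self_eq_norm_sq]

/-- Weights are at most one, so a single curvature constant serves for all base points. -/
lemma objective_le (hρ : IsLossKernel ρ) (X Z : Conf d n) :
    P.objective ρ X ≤ P.objective ρ Z + inner ℝ (gradient (P.objective ρ) Z) (X - Z)
      + 1 / 2 * P.omegaBound * ‖X - Z‖ ^ 2 := by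
  rw [P.gradient_objective hρ, sum_inner, objective, objective, omegaBound, Finset.mul_sum,
    Finset.sum_mul, ← Finset.sum_add_distrib, ← Finset.sum_add_distrib]
  refine Finset.sum_le_sum fun e he => ?_
  have h1 := P.edgeF_le hρ he X Z
  have h2 := P.sqM_le_sqOmega he (X - Z)
  have h3 := (le_abs_self _).trans (P.abs_bilinOmega_le e (X - Z) (X - Z))
  rw [← P.sqOmega_eq_bilinOmega he] at h3
  have h4 : P.weight ρ e Z * P.sqM e (X - Z) ≤ P.sqM e (X - Z) :=
    mul_le_of_le_one_left (P.sqM_nonneg he _) (P.weight_le_one hρ he Z)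
  nlinarith

/-- The gradient of a nonnegative function with a quadratic upper model is controlled by its
value. -/
lemma norm_gradient_objective_sq_le (hρ : IsLossKernel ρ) (Z : Conf d n) :
    ‖gradient (P.objective ρ) Z‖ ^ 2 ≤ 2 * (P.omegaBound + 1) * P.objective ρ Z := by
  set g := gradient (P.objective ρ) Z with hg
  have hC := P.omegaBound_nonneg
  set C := P.omegaBound
  -- A gradient step cannot push the value below zero. The step length is `(C + 1)⁻¹` because `C`
  -- may vanish.
  have h1 := P.objective_le hρ (Z - (C + 1)⁻¹ • g) Z
  have h2 := P.objective_nonneg hρ (Z - (C + 1)⁻¹ • g)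
  have h3 : Z - (C + 1)⁻¹ • g - Z = -((C + 1)⁻¹ • g) := by abel
  rw [h3, norm_neg, inner_neg_right, ← hg, inner_smul_right, real_inner_self_eq_norm_sq, norm_smul,
    Real.norm_of_nonneg (by positivity), mul_pow] at h1
  have h4 : (C + 1) * (C + 1)⁻¹ = 1 := mul_inv_cancel₀ (by positivity)
  set r := (C + 1)⁻¹
  have h5 : 0 ≤ r := by positivity
  have h6 : 1 / 2 * C * (r ^ 2 * ‖g‖ ^ 2) ≤ 1 / 2 * r * ‖g‖ ^ 2 := by
    have : C * r ≤ 1 := by linarith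
    have h7 : C * r * (r * ‖g‖ ^ 2) ≤ 1 * (r * ‖g‖ ^ 2) := by gcongr
    nlinarith
  have h8 : r * ‖g‖ ^ 2 ≤ 2 * P.objective ρ Z := by linarith
  have h9 := mul_le_mul_of_nonneg_left h8 (show 0 ≤ C + 1 by positivity)
  calc ‖g‖ ^ 2 = (C + 1) * r * ‖g‖ ^ 2 := by rw [h4, one_mul]
    _ = (C + 1) * (r * ‖g‖ ^ 2) := by ring
    _ ≤ (C + 1) * (2 * P.objective ρ Z) := h9
    _ = _ := by ring

/-! ### Sums over the edges, sorted by nodes -/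

lemma mem_edges_of_mem_intraEdges {P : PoseGraph d n} {e : Vertex n × Vertex n}
    (he : e ∈ P.intraEdges) : e ∈ P.edges := Finset.mem_of_mem_filter e he

lemma mem_edges_of_mem_interEdges {P : PoseGraph d n} {e : Vertex n × Vertex n}
    (he : e ∈ P.interEdges) : e ∈ P.edges := Finset.mem_of_mem_filter e he

lemma ne_of_mem_interEdges {P : PoseGraph d n} {e : Vertex n × Vertex n}
    (he : e ∈ P.interEdges) : e.1.1 ≠ e.2.1 := (Finset.mem_filter.1 he).2

lemma eq_of_mem_intraEdges {P : PoseGraph d n} {e : Vertex n × Vertex n}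
    (he : e ∈ P.intraEdges) : e.1.1 = e.2.1 := (Finset.mem_filter.1 he).2

lemma mem_edgesBetween {P : PoseGraph d n} {α β : A} {e : Vertex n × Vertex n} :
    e ∈ P.edgesBetween α β ↔ e ∈ P.edges ∧ e.1.1 = α ∧ e.2.1 = β := Finset.mem_filter

lemma mem_neighbors {P : PoseGraph d n} {α β : A} : β ∈ P.neighbors α ↔
    α ≠ β ∧ ((P.edgesBetween α β).Nonempty ∨ (P.edgesBetween β α).Nonempty) := by
  simp [neighbors]

lemma mem_neighbors_comm {P : PoseGraph d n} {α β : A} :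
    β ∈ P.neighbors α ↔ α ∈ P.neighbors β := by
  rw [mem_neighbors, mem_neighbors, ne_comm, or_comm]

lemma sum_edges (f : Vertex n × Vertex n → ℝ) :
    ∑ e ∈ P.edges, f e = ∑ e ∈ P.intraEdges, f e + ∑ e ∈ P.interEdges, f e :=
  (Finset.sum_filter_add_sum_filter_not _ _ _).symm

lemma sum_neighbors_edgesBetween (α : A) (f : Vertex n × Vertex n → ℝ) :
    ∑ β ∈ P.neighbors α, ∑ e ∈ P.edgesBetween α β, f e
      = ∑ e ∈ P.interEdges with e.1.1 = α, f e := by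
  rw [← Finset.sum_fiberwise_of_maps_to (t := P.neighbors α) (g := fun e : Vertex n × Vertex n => e.2.1)]
  · refine Finset.sum_congr rfl fun β hβ => Finset.sum_congr ?_ fun _ _ => rfl
    have hne := (mem_neighbors.1 hβ).1
    ext e
    simp only [mem_edgesBetween, interEdges, Finset.mem_filter]
    constructor
    · rintro ⟨h1, h2, h3⟩
      exact ⟨⟨⟨h1, by rw [h2, h3]; exact hne⟩, h2⟩, h3⟩
    · rintro ⟨⟨⟨h1, _⟩, h2⟩, h3⟩
      exact ⟨h1, h2, h3⟩
  · intro e he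
    simp only [interEdges, Finset.mem_filter] at he
    exact mem_neighbors.2 ⟨by rw [← he.2]; exact he.1.2,
      Or.inl ⟨e, mem_edgesBetween.2 ⟨he.1.1, he.2, rfl⟩⟩⟩

lemma sum_neighbors_edgesBetween' (α : A) (f : Vertex n × Vertex n → ℝ) :
    ∑ β ∈ P.neighbors α, ∑ e ∈ P.edgesBetween β α, f e
      = ∑ e ∈ P.interEdges with e.2.1 = α, f e := by
  rw [← Finset.sum_fiberwise_of_maps_to (t := P.neighbors α) (g := fun e : Vertex n × Vertex n => e.1.1)]
  · refine Finset.sum_congr rfl fun β hβ => Finset.sum_congr ?_ fun _ _ => rfl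
    have hne := (mem_neighbors.1 hβ).1
    ext e
    simp only [mem_edgesBetween, interEdges, Finset.mem_filter]
    constructor
    · rintro ⟨h1, h2, h3⟩
      exact ⟨⟨⟨h1, by rw [h2, h3]; exact hne.symm⟩, h3⟩, h2⟩
    · rintro ⟨⟨⟨h1, _⟩, h2⟩, h3⟩
      exact ⟨h1, h3, h2⟩
  · intro e he
    simp only [interEdges, Finset.mem_filter] at he
    exact mem_neighbors.2 ⟨by rw [← he.2]; exact he.1.2.symm,
      Or.inr ⟨e, mem_edgesBetween.2 ⟨he.1.1, rfl, he.2⟩⟩⟩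

/-- Edges touching `α` split into outgoing and incoming ones without overlap, since an edge between
different nodes cannot do both. This turns the global sums in `nodeG` into the neighbour sums of the
local bookkeeping. -/
lemma sum_interEdges_eq_sum_neighbors (α : A) (f : Vertex n × Vertex n → ℝ)
    (hf : ∀ e ∈ P.interEdges, e.1.1 ≠ α → e.2.1 ≠ α → f e = 0) :
    ∑ e ∈ P.interEdges, f e = ∑ β ∈ P.neighbors α,
      (∑ e ∈ P.edgesBetween α β, f e + ∑ e ∈ P.edgesBetween β α, f e) := by
  rw [Finset.sum_add_distrib, sum_neighbors_edgesBetween, sum_neighbors_edgesBetween',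
    ← Finset.sum_filter_add_sum_filter_not P.interEdges (fun e => e.1.1 = α)]
  congr 1
  symm
  refine Finset.sum_subset ?_ ?_
  · intro e he
    rw [Finset.mem_filter] at he ⊢
    exact ⟨he.1, fun h => ne_of_mem_interEdges he.1 (h.trans he.2.symm)⟩
  · intro e he he'
    rw [Finset.mem_filter] at he he'
    exact hf e he.1 he.2 fun h => he' ⟨he.1, h⟩

lemma sum_sum_neighbors_edgesBetween (f : Vertex n × Vertex n → ℝ) :
    ∑ α, ∑ β ∈ P.neighbors α, ∑ e ∈ P.edgesBetween α β, f e = ∑ e ∈ P.interEdges, f e := by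
  simp only [sum_neighbors_edgesBetween]
  exact Finset.sum_fiberwise _ _ _

lemma sum_sum_neighbors_comm (g : A → A → ℝ) :
    ∑ α, ∑ β ∈ P.neighbors α, g α β = ∑ α, ∑ β ∈ P.neighbors α, g β α :=
  Finset.sum_comm' fun α β => by simp [mem_neighbors_comm (P := P) (α := α)]

/-! ### Splitting the surrogates into nodes -/

lemma inner_gradient_edgeF_node (hρ : IsLossKernel ρ) {e : Vertex n × Vertex n}
    (he : e ∈ P.edges) (Z : Conf d n) (γ : A) (x : NodeConf d (n γ)) :
    inner ℝ (gradient (P.edgeF ρ e) Z γ) x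
      = P.weight ρ e Z * inner ℝ (P.edgeMap e Z) (P.edgeMap e (embed γ x)) := by
  rw [← inner_embed, P.inner_gradient_edgeF hρ he]

/-- The contribution of the node `γ` to `E_ij^{αβ}(· | Z)`. -/
def edgeNodeE (ρ : ℝ → ℝ) (e : Vertex n × Vertex n) (γ : A) (x : NodeConf d (n γ))
    (Z : Conf d n) : ℝ :=
  1 / 2 * P.weight ρ e Z * P.sqOmega e (embed γ (x - Z γ))
    + inner ℝ (gradient (P.edgeF ρ e) Z γ) (x - Z γ)

lemma edgeNodeE_of_ne (hρ : IsLossKernel ρ) {e : Vertex n × Vertex n} (he : e ∈ P.edges) {γ : A}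
    (h : e.1.1 ≠ γ) (h' : e.2.1 ≠ γ) (x : NodeConf d (n γ)) (Z : Conf d n) :
    P.edgeNodeE ρ e γ x Z = 0 := by
  rw [edgeNodeE, P.sqOmega_embed_of_ne he h h', P.inner_gradient_edgeF_node hρ he,
    P.edgeMap_embed_of_ne h h']
  simp

lemma edgeMap_eq_add_embed {e : Vertex n × Vertex n} (hne : e.1.1 ≠ e.2.1) (X : Conf d n) :
    P.edgeMap e X = P.edgeMap e (embed e.1.1 (X e.1.1)) + P.edgeMap e (embed e.2.1 (X e.2.1)) := by
  simp only [edgeMap_apply]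
  rw [P.headMap_embed_of_ne hne, P.tailMap_embed_of_ne hne.symm,
    P.headMap_congr e (X := X) (Y := embed e.1.1 (X e.1.1)) (by simp),
    P.tailMap_congr e (X := X) (Y := embed e.2.1 (X e.2.1)) (by simp)]
  abel

/-- The quadratic part is block diagonal and the gradient part is linear, so the model of an edge
separates into one term per endpoint. -/
lemma edgeE_eq (hρ : IsLossKernel ρ) {e : Vertex n × Vertex n} (he : e ∈ P.edges)
    (hne : e.1.1 ≠ e.2.1) (X Z : Conf d n) : P.edgeE ρ e X Z
      = P.edgeNodeE ρ e e.1.1 (X e.1.1) Z + P.edgeNodeE ρ e e.2.1 (X e.2.1) Z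
        + P.edgeF ρ e Z := by
  rw [edgeE, edgeNodeE, edgeNodeE, P.sqOmega_eq_add_embed he hne, P.inner_gradient_edgeF hρ he,
    P.edgeMap_eq_add_embed hne (X - Z), inner_add_right, P.inner_gradient_edgeF_node hρ he,
    P.inner_gradient_edgeF_node hρ he]
  simp only [PiLp.sub_apply]
  ring

lemma gradient_pairF (hρ : IsLossKernel ρ) (α β : A) (Z : Conf d n) :
    gradient (P.pairF ρ α β) Z = ∑ e ∈ P.edgesBetween α β, gradient (P.edgeF ρ e) Z
      + ∑ e ∈ P.edgesBetween β α, gradient (P.edgeF ρ e) Z := by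
  have h : ∀ α β : A, ∀ e ∈ P.edgesBetween α β, DifferentiableAt ℝ (P.edgeF ρ e) Z :=
    fun α β e he => P.differentiableAt_edgeF hρ (mem_edgesBetween.1 he).1 Z
  rw [← gradient_sum _ _ _ (h α β), ← gradient_sum _ _ _ (h β α)]
  simp only [gradient]
  rw [← map_add, ← fderiv_fun_add (DifferentiableAt.fun_sum (h α β))
    (DifferentiableAt.fun_sum (h β α))]
  rfl

lemma sum_node_apply {ι : Type*} (s : Finset ι) (f : ι → Conf d n) (α : A) :
    (∑ i ∈ s, f i) α = ∑ i ∈ s, f i α := by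
  simp

lemma partE_eq (hρ : IsLossKernel ρ) (α β : A) (x : NodeConf d (n α)) (Z : Conf d n) :
    P.partE ρ α β x Z = ∑ e ∈ P.edgesBetween α β, P.edgeNodeE ρ e α x Z
      + ∑ e ∈ P.edgesBetween β α, P.edgeNodeE ρ e α x Z := by
  simp only [partE, sqOmegaPart, edgeNodeE, P.gradient_pairF hρ, PiLp.add_apply, sum_node_apply,
    inner_add_left, sum_inner, Finset.sum_add_distrib, mul_assoc, ← Finset.mul_sum]
  ring

lemma pairF_comm (α β : A) : P.pairF ρ α β = P.pairF ρ β α := by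
  funext X; rw [pairF, pairF, add_comm]

lemma pairE_comm (α β : A) : P.pairE ρ α β = P.pairE ρ β α := by
  funext X Z; rw [pairE, pairE, add_comm]

lemma pairE_eq (hρ : IsLossKernel ρ) {α β : A} (h : α ≠ β) (X Z : Conf d n) :
    P.pairE ρ α β X Z
      = P.partE ρ α β (X α) Z + P.partE ρ β α (X β) Z + P.pairF ρ α β Z := by
  have h1 : ∑ e ∈ P.edgesBetween α β, P.edgeE ρ e X Z = ∑ e ∈ P.edgesBetween α β,
      (P.edgeNodeE ρ e α (X α) Z + P.edgeNodeE ρ e β (X β) Z + P.edgeF ρ e Z) := by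
    refine Finset.sum_congr rfl fun e he => ?_
    obtain ⟨he', rfl, rfl⟩ := mem_edgesBetween.1 he
    rw [P.edgeE_eq hρ he' h]
  have h2 : ∑ e ∈ P.edgesBetween β α, P.edgeE ρ e X Z = ∑ e ∈ P.edgesBetween β α,
      (P.edgeNodeE ρ e α (X α) Z + P.edgeNodeE ρ e β (X β) Z + P.edgeF ρ e Z) := by
    refine Finset.sum_congr rfl fun e he => ?_
    obtain ⟨he', rfl, rfl⟩ := mem_edgesBetween.1 he
    rw [P.edgeE_eq hρ he' h.symm]
    ring
  rw [pairE, h1, h2, P.partE_eq hρ, P.partE_eq hρ, pairF]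
  simp only [Finset.sum_add_distrib]
  ring

lemma pairF_le_pairE (hρ : IsLossKernel ρ) (α β : A) (X Z : Conf d n) :
    P.pairF ρ α β X ≤ P.pairE ρ α β X Z :=
  add_le_add
    (Finset.sum_le_sum fun _ he => P.edgeF_le_edgeE hρ (mem_edgesBetween.1 he).1 X Z)
    (Finset.sum_le_sum fun _ he => P.edgeF_le_edgeE hρ (mem_edgesBetween.1 he).1 X Z)

/-! ### The local objective values add up to the objective -/

/-- By `pairE_eq` the two increments `partE` add up to `pairE` minus the old `pairF`. The induction
hypothesis cancels the old value and the two halves of the correction cancel `pairE`. -/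
lemma partF_add_partF (hρ : IsLossKernel ρ) (X : ℕ → Conf d n) {α β : A} (h : α ≠ β) (k : ℕ) :
    P.partF ρ X α β k + P.partF ρ X β α k = P.pairF ρ α β (X k) := by
  induction k with
  | zero => rw [partF, partF, P.pairF_comm β α]; ring
  | succ k ih =>
    rw [partF, partF, P.pairF_comm β α, P.pairE_comm β α, P.pairE_eq hρ h]
    linarith

lemma edgeF_embed {e : Vertex n × Vertex n} (he : e ∈ P.edges) (heq : e.1.1 = e.2.1)
    (X : Conf d n) : P.edgeF ρ e (embed e.1.1 (X e.1.1)) = P.edgeF ρ e X := by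
  rw [edgeF, edgeF, if_pos heq, if_pos heq, ← P.sqM_eq_embed he heq]

lemma selfF_eq (α : A) (X : Conf d n) :
    P.selfF ρ α (X α) = ∑ e ∈ P.intraEdges with e.1.1 = α, P.edgeF ρ e X := by
  rw [selfF]
  refine Finset.sum_congr ?_ fun e he => ?_
  · ext e
    simp only [mem_edgesBetween, intraEdges, Finset.mem_filter]
    constructor
    · rintro ⟨h1, h2, h3⟩
      exact ⟨⟨h1, h2.trans h3.symm⟩, h2⟩
    · rintro ⟨⟨h1, h2⟩, h3⟩
      exact ⟨h1, h3, h2.symm.trans h3⟩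
  · obtain ⟨he', rfl⟩ := Finset.mem_filter.1 he
    exact P.edgeF_embed (mem_edges_of_mem_intraEdges he') (eq_of_mem_intraEdges he') X

lemma sum_selfF (X : Conf d n) : ∑ α, P.selfF ρ α (X α) = ∑ e ∈ P.intraEdges, P.edgeF ρ e X := by
  simp only [selfF_eq]
  exact Finset.sum_fiberwise _ _ _

lemma sum_nodeF (hρ : IsLossKernel ρ) (X : ℕ → Conf d n) (k : ℕ) :
    ∑ α, P.nodeF ρ X α k = P.objective ρ (X k) := by
  simp only [nodeF, Finset.sum_add_distrib]
  rw [sum_selfF, objective, sum_edges]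
  congr 1
  have h1 := P.sum_sum_neighbors_comm fun α β => P.partF ρ X α β k
  have h2 : ∑ α, ∑ β ∈ P.neighbors α, P.partF ρ X α β k
      + ∑ α, ∑ β ∈ P.neighbors α, P.partF ρ X β α k
      = ∑ α, ∑ β ∈ P.neighbors α, P.pairF ρ α β (X k) := by
    simp only [← Finset.sum_add_distrib]
    exact Finset.sum_congr rfl fun α _ => Finset.sum_congr rfl fun β hβ =>
      P.partF_add_partF hρ X (mem_neighbors.1 hβ).1 k
  -- The sum runs over ordered pairs of nodes while `pairF` is symmetric, so each edge is counted
  -- twice; this matches the doubling in `h2`.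
  have h3 : ∑ α, ∑ β ∈ P.neighbors α, P.pairF ρ α β (X k)
      = ∑ e ∈ P.interEdges, P.edgeF ρ e (X k) + ∑ e ∈ P.interEdges, P.edgeF ρ e (X k) := by
    simp only [pairF, Finset.sum_add_distrib]
    rw [P.sum_sum_neighbors_comm fun α β => ∑ e ∈ P.edgesBetween β α, P.edgeF ρ e (X k),
      P.sum_sum_neighbors_edgesBetween]
  linarith

lemma sum_nodeFbar (hρ : IsLossKernel ρ) (η : ℝ) (X : ℕ → Conf d n) (k : ℕ) :
    ∑ α, P.nodeFbar ρ η X α k = P.objectiveBar ρ η X k := by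
  induction k with
  | zero =>
    simp only [nodeFbar, objectiveBar, Finset.sum_add_distrib, ← Finset.mul_sum, P.sum_nodeF hρ]
  | succ k ih =>
    simp only [nodeFbar, objectiveBar, Finset.sum_add_distrib, ← Finset.mul_sum, P.sum_nodeF hρ,
      ih]

/-! ### The surrogate `G` majorizes -/

/-- The terms inside a node are exactly quadratic. The sum may run over the intra-node edges of all
nodes, as in `sqGamma`, because those of other nodes contribute zero. -/
lemma selfF_expand (hρ : IsLossKernel ρ) (Z : Conf d n) (α : A) (x : NodeConf d (n α)) :
    P.selfF ρ α x = P.selfF ρ α (Z α) + ∑ e ∈ P.intraEdges,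
      (1 / 2 * P.sqM e (embed α (x - Z α)) + inner ℝ (gradient (P.edgeF ρ e) Z α) (x - Z α)) := by
  have hx : ((Z + embed α (x - Z α) : Conf d n)) α = x := by
    rw [PiLp.add_apply, embed_apply_self]; abel
  have h1 : ∑ e ∈ P.intraEdges,
      (1 / 2 * P.sqM e (embed α (x - Z α)) + inner ℝ (gradient (P.edgeF ρ e) Z α) (x - Z α))
      = ∑ e ∈ P.intraEdges with e.1.1 = α,
      (1 / 2 * P.sqM e (embed α (x - Z α))
        + inner ℝ (gradient (P.edgeF ρ e) Z α) (x - Z α)) := by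
    symm
    refine Finset.sum_subset (Finset.filter_subset _ _) fun e he he' => ?_
    have hne : e.1.1 ≠ α := fun h => he' (Finset.mem_filter.2 ⟨he, h⟩)
    have hne' : e.2.1 ≠ α := by rw [← eq_of_mem_intraEdges he]; exact hne
    have he := mem_edges_of_mem_intraEdges he
    rw [P.sqM_embed_of_ne he hne hne', P.inner_gradient_edgeF_node hρ he,
      P.edgeMap_embed_of_ne hne hne']
    simp
  have h2 : P.selfF ρ α x = P.selfF ρ α ((Z + embed α (x - Z α) : Conf d n) α) := by rw [hx]
  rw [h1, h2, selfF_eq, selfF_eq, ← Finset.sum_add_distrib]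
  refine Finset.sum_congr rfl fun e he => ?_
  have he := (Finset.mem_filter.1 he).1
  rw [P.edgeF_expand hρ (mem_edges_of_mem_intraEdges he) (eq_of_mem_intraEdges he) _ Z,
    add_sub_cancel_left, inner_embed]
  ring

/-- In this form the surrogate has the same ingredients as the recursion for `nodeF`, so the two can
be compared term by term. -/
lemma nodeG_self_eq (hρ : IsLossKernel ρ) (ξ : ℝ) (Z : Conf d n) (α : A)
    (x : NodeConf d (n α)) : P.nodeG ρ ξ Z Z α x
      = P.selfF ρ α x - P.selfF ρ α (Z α) + ∑ β ∈ P.neighbors α, P.partE ρ α β x Z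
        + ξ / 2 * ‖x - Z α‖ ^ 2 := by
  have h1 : ∑ β ∈ P.neighbors α, P.partE ρ α β x Z
      = ∑ e ∈ P.interEdges, P.edgeNodeE ρ e α x Z := by
    rw [P.sum_interEdges_eq_sum_neighbors α _ fun e he h h' =>
      P.edgeNodeE_of_ne hρ (mem_edges_of_mem_interEdges he) h h' x Z]
    exact Finset.sum_congr rfl fun β _ => P.partE_eq hρ α β x Z
  have h2 : inner ℝ (gradient (P.objective ρ) Z α) (x - Z α)
      = ∑ e ∈ P.intraEdges, inner ℝ (gradient (P.edgeF ρ e) Z α) (x - Z α)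
        + ∑ e ∈ P.interEdges, inner ℝ (gradient (P.edgeF ρ e) Z α) (x - Z α) := by
    rw [P.gradient_objective hρ, sum_node_apply, sum_inner, sum_edges]
  rw [h1, P.selfF_expand hρ Z, nodeG, sqGamma, h2]
  simp only [edgeNodeE, Finset.sum_add_distrib, mul_assoc, ← Finset.mul_sum]
  ring

/-- The only part of the update that the surrogate does not see is half of `pairF - pairE`, which is
nonpositive; the proximal term of the surrogate is left over as slack. -/
lemma nodeF_succ_le (hρ : IsLossKernel ρ) (ξ : ℝ) (X : ℕ → Conf d n) (α : A) (k : ℕ) :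
    P.nodeF ρ X α (k + 1) ≤ P.nodeG ρ ξ (X k) (X k) α (X (k + 1) α) + P.nodeF ρ X α k
      - ξ / 2 * ‖X (k + 1) α - X k α‖ ^ 2 := by
  have h : ∑ β ∈ P.neighbors α, P.partF ρ X α β (k + 1)
      ≤ ∑ β ∈ P.neighbors α, P.partE ρ α β (X (k + 1) α) (X k)
        + ∑ β ∈ P.neighbors α, P.partF ρ X α β k := by
    rw [← Finset.sum_add_distrib]
    refine Finset.sum_le_sum fun β _ => ?_
    have := P.pairF_le_pairE hρ α β (X (k + 1)) (X k)
    rw [partF]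
    linarith
  rw [P.nodeG_self_eq hρ, nodeF, nodeF]
  linarith

lemma nodeG_le_nodeH (ξ ζ : ℝ) (X Z : Conf d n) (α : A) (x : NodeConf d (n α)) :
    P.nodeG ρ ξ X Z α x ≤ P.nodeH ρ ζ X Z α x - (ζ - ξ) / 2 * ‖x - Z α‖ ^ 2 := by
  have h : ∑ e ∈ P.intraEdges, P.sqM e (embed α (x - Z α))
      ≤ ∑ e ∈ P.intraEdges, P.sqOmega e (embed α (x - Z α)) :=
    Finset.sum_le_sum fun e he => P.sqM_le_sqOmega (mem_edges_of_mem_intraEdges he) _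
  rw [nodeG, nodeH, sqGamma, sqPi]
  linarith

end PoseGraph

/-! ### The momentum -/

lemma le_nesterov (s : ℝ) : s ≤ nesterov s := by
  have h : 2 * s ≤ √(4 * s ^ 2 + 1) := Real.le_sqrt_of_sq_le (by nlinarith)
  rw [nesterov]; linarith

/-- The lower bound one is all the convergence proof needs from the momentum, which is why every
reading of the restart rule is admissible. -/
lemma IsRestartedMomentum.one_le {s s' : ℝ} (h : IsRestartedMomentum s s') (hs : 1 ≤ s) :
    1 ≤ s' := by
  rcases h with h | h | h
  · rw [h]; exact hs.trans (le_nesterov s)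
  · rw [h]; exact le_max_right _ _
  · rw [h]; exact (le_max_right _ _).trans (le_nesterov _)

/-- Each node's momentum factor lies in `[0, 1]`, since `1 ≤ s ≤ nesterov s`. -/
lemma norm_extrapolate_sub_le (X : ℕ → Conf d n) (s : ℕ → A → ℝ) (k : ℕ)
    (hs : ∀ α, 1 ≤ s k α) : ‖extrapolate X s k - X k‖ ≤ ‖X k - X (k - 1)‖ := by
  rw [← sq_le_sq₀ (norm_nonneg _) (norm_nonneg _), norm_sq_eq_sum_node, norm_sq_eq_sum_node]
  refine Finset.sum_le_sum fun α _ => ?_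
  have h : (extrapolate X s k - X k) α
      = ((s k α - 1) / nesterov (s k α)) • (X k - X (k - 1)) α := by
    simp [extrapolate]
  have h1 := le_nesterov (s k α)
  have h2 := hs α
  have h3 : 0 ≤ (s k α - 1) / nesterov (s k α) := div_nonneg (by linarith) (by linarith)
  have h4 : (s k α - 1) / nesterov (s k α) ≤ 1 := div_le_one_of_le₀ (by linarith) (by linarith)
  rw [h, norm_smul, Real.norm_of_nonneg h3]
  exact pow_le_pow_left₀ (by positivity) (mul_le_of_le_one_left (norm_nonneg _) h4) 2

/-! ### One step of the method -/

namespace NodeStep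

variable {P : PoseGraph d n} {ρ : ℝ → ℝ} {p : Params} {X Xh : ℕ → Conf d n} {s : ℕ → A → ℝ}
  {k : ℕ} {α : A}

lemma isArgminH (h : NodeStep P ρ p X Xh s k α) :
    P.IsArgminH ρ p.ζ (X k) (extrapolate X s k) α (Xh k α)
      ∨ P.IsArgminH ρ p.ζ (X k) (X k) α (Xh k α) := by
  obtain ⟨h₀, x₀, x₁, hh, hx, h1, h2, h3, h4, h5, h6⟩ := h
  by_cases hc : P.nodeG ρ p.ξ (X k) (X k) α h₀ + P.nodeF ρ X α k
      > P.nodeFbar ρ p.η X α k - p.ψ * ‖h₀ - X k α‖ ^ 2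
  · exact Or.inr (h1 hc)
  · rw [h2 hc]; exact Or.inl hh

lemma half_mem (h : NodeStep P ρ p X Xh s k α) : Xh k α ∈ nodeFeasible d (n α) :=
  h.isArgminH.elim (·.1) (·.1)

lemma next_mem (h : NodeStep P ρ p X Xh s k α) : X (k + 1) α ∈ nodeFeasible d (n α) := by
  have hm := h.half_mem
  obtain ⟨h₀, x₀, x₁, hh, hx, h1, h2, h3, h4, h5, h6⟩ := h
  have hx₁ : x₁ ∈ nodeFeasible d (n α) := by
    by_cases hc : P.nodeG ρ p.ξ (X k) (X k) α x₀ + P.nodeF ρ X α k > P.nodeFbar ρ p.η X α k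
    · exact (h3 hc).1
    · rw [(h4 hc).1]; exact hx
  by_cases hc : P.nodeFbar ρ p.η X α k - (P.nodeG ρ p.ξ (X k) (X k) α x₁ + P.nodeF ρ X α k)
      < p.φ * (P.nodeFbar ρ p.η X α k
        - (P.nodeG ρ p.ξ (X k) (X k) α (Xh k α) + P.nodeF ρ X α k))
  · rw [h5 hc]; exact hm
  · rw [h6 hc]; exact hx₁

lemma isRestartedMomentum (h : NodeStep P ρ p X Xh s k α) :
    IsRestartedMomentum (s k α) (s (k + 1) α) := by
  obtain ⟨h₀, x₀, x₁, hh, hx, h1, h2, h3, h4, h5, h6⟩ := h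
  by_cases hc : P.nodeG ρ p.ξ (X k) (X k) α x₀ + P.nodeF ρ X α k > P.nodeFbar ρ p.η X α k
  · exact (h3 hc).2
  · exact Or.inl (h4 hc).2

/-- If the test accepts the extrapolated half step, the test itself is the bound with `ψ`. Otherwise
the half step minimizes `nodeH` at the current iterate, and the gap between `nodeH` and `nodeG`
supplies `(ζ - ξ) / 2`. -/
lemma half_descent (h : NodeStep P ρ p X Xh s k α) (hX : X k α ∈ nodeFeasible d (n α))
    (hF : P.nodeF ρ X α k ≤ P.nodeFbar ρ p.η X α k) :
    P.nodeG ρ p.ξ (X k) (X k) α (Xh k α) + P.nodeF ρ X α k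
      ≤ P.nodeFbar ρ p.η X α k - min p.ψ ((p.ζ - p.ξ) / 2) * ‖Xh k α - X k α‖ ^ 2 := by
  obtain ⟨h₀, x₀, x₁, hh, hx, h1, h2, h3, h4, h5, h6⟩ := h
  by_cases hc : P.nodeG ρ p.ξ (X k) (X k) α h₀ + P.nodeF ρ X α k
      > P.nodeFbar ρ p.η X α k - p.ψ * ‖h₀ - X k α‖ ^ 2
  · have hm := (h1 hc).2 _ hX
    -- The feasible competitor is the current iterate, where the model vanishes.
    have h0 : P.nodeH ρ p.ζ (X k) (X k) α (X k α) = 0 := by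
      have : (embed α (0 : NodeConf d (n α)) : Conf d n) = 0 := by
        simpa using embed_sub α (0 : NodeConf d (n α)) 0
      have hM : ∀ e ∈ P.intraEdges, P.sqOmega e (0 : Conf d n) = 0 := fun e he => by
        rw [P.sqOmega_eq (mem_edges_of_mem_intraEdges he)]; simp
      have hO : ∀ e ∈ P.interEdges, P.weight ρ e (X k) * P.sqOmega e (0 : Conf d n) = 0 :=
        fun e he => by rw [P.sqOmega_eq (mem_edges_of_mem_interEdges he)]; simp
      rw [nodeH, sqPi, sub_self, this, Finset.sum_eq_zero hM, Finset.sum_eq_zero hO]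
      simp
    have hG := P.nodeG_le_nodeH (ρ := ρ) p.ξ p.ζ (X k) (X k) α (Xh k α)
    have hmin := mul_le_mul_of_nonneg_right (min_le_right p.ψ ((p.ζ - p.ξ) / 2))
      (sq_nonneg ‖Xh k α - X k α‖)
    linarith
  · have hmin := mul_le_mul_of_nonneg_right (min_le_left p.ψ ((p.ζ - p.ξ) / 2))
      (sq_nonneg ‖Xh k α - X k α‖)
    rw [← h2 hc] at hc
    linarith

/-- The last test compares with the half step, so the quality of `x₀` and `x₁` is irrelevant: a
rejected point is replaced by the half step, and an accepted one inherits the fraction `φ` of its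
decrease. -/
lemma descent (h : NodeStep P ρ p X Xh s k α) (hX : X k α ∈ nodeFeasible d (n α))
    (hF : P.nodeF ρ X α k ≤ P.nodeFbar ρ p.η X α k) :
    P.nodeG ρ p.ξ (X k) (X k) α (X (k + 1) α) + P.nodeF ρ X α k
      ≤ P.nodeFbar ρ p.η X α k
        - p.φ * min p.ψ ((p.ζ - p.ξ) / 2) * ‖Xh k α - X k α‖ ^ 2 := by
  have hd := h.half_descent hX hF
  obtain ⟨h₀, x₀, x₁, hh, hx, h1, h2, h3, h4, h5, h6⟩ := h
  have hc0 : 0 ≤ min p.ψ ((p.ζ - p.ξ) / 2) :=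
    le_min p.ψ_pos.le (by linarith [p.ξ_le_ζ])
  have hD : 0 ≤ min p.ψ ((p.ζ - p.ξ) / 2) * ‖Xh k α - X k α‖ ^ 2 := by positivity
  have hφ := mul_le_of_le_one_left hD p.φ_le_one
  by_cases hc : P.nodeFbar ρ p.η X α k - (P.nodeG ρ p.ξ (X k) (X k) α x₁ + P.nodeF ρ X α k)
      < p.φ * (P.nodeFbar ρ p.η X α k
        - (P.nodeG ρ p.ξ (X k) (X k) α (Xh k α) + P.nodeF ρ X α k))
  · rw [h5 hc]; linarith
  · rw [h6 hc]
    have := mul_le_mul_of_nonneg_left (le_sub_comm.1 hd) p.φ_pos.le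
    linarith

end NodeStep

/-! ### Descent along a run -/

/-- The constant in the sufficient decrease of `F̄`. -/
def Params.decrease (p : Params) : ℝ :=
  p.η * min (p.φ * min p.ψ ((p.ζ - p.ξ) / 2)) (p.ξ / 2)

lemma Params.decrease_nonneg (p : Params) : 0 ≤ p.decrease := by
  have h : 0 ≤ min p.ψ ((p.ζ - p.ξ) / 2) := le_min p.ψ_pos.le (by linarith [p.ξ_le_ζ])
  exact mul_nonneg p.η_pos.le (le_min (mul_nonneg p.φ_pos.le h) (by linarith [p.ξ_nonneg]))

lemma Params.decrease_pos (p : Params) (h : p.ξ < p.ζ) (hξ : 0 < p.ξ) : 0 < p.decrease := by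
  have h : 0 < min p.ψ ((p.ζ - p.ξ) / 2) := lt_min p.ψ_pos (by linarith)
  exact mul_pos p.η_pos (lt_min (mul_pos p.φ_pos h) (by linarith))

namespace IsRun

variable {P : PoseGraph d n} {ρ : ℝ → ℝ} {p : Params} {X Xh : ℕ → Conf d n}

lemma mem_feasible (h : IsRun P ρ p X Xh) (k : ℕ) : X k ∈ feasible d n := by
  obtain ⟨h0, s, -, hs⟩ := h
  cases k with
  | zero => exact h0
  | succ k => exact fun α => (hs k α).next_mem

lemma half_mem_feasible (h : IsRun P ρ p X Xh) (k : ℕ) : Xh k ∈ feasible d n := by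
  obtain ⟨h0, s, -, hs⟩ := h
  exact fun α => (hs k α).half_mem

/-- The half step minimizes `H^α(· | Z)` for a point `Z` near `X^{(k)}`. -/
lemma exists_isArgminH (h : IsRun P ρ p X Xh) (k : ℕ) (α : A) :
    ∃ Z : Conf d n, ‖Z - X k‖ ≤ ‖X k - X (k - 1)‖ ∧ P.IsArgminH ρ p.ζ (X k) Z α (Xh k α) := by
  obtain ⟨-, s, hs0, hs⟩ := h
  have hs1 : ∀ k α, 1 ≤ s k α := by
    intro k α
    induction k with
    | zero => rw [hs0]
    | succ k ih => exact (hs k α).isRestartedMomentum.one_le ih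
  rcases (hs k α).isArgminH with h | h
  · exact ⟨_, norm_extrapolate_sub_le X s k (hs1 k), h⟩
  · exact ⟨X k, by simp, h⟩

lemma nodeFbar_succ (η : ℝ) (α : A) (k : ℕ) : P.nodeFbar ρ η X α (k + 1)
    = (1 - η) * P.nodeFbar ρ η X α k + η * P.nodeF ρ X α (k + 1) := rfl

/-- This invariant and the descent feed each other: the descent at step `k` needs it, and then puts
the next local value below the old average, hence below the new one. -/
lemma nodeF_le_nodeFbar (h : IsRun P ρ p X Xh) (hρ : IsLossKernel ρ) (α : A) (k : ℕ) :
    P.nodeF ρ X α k ≤ P.nodeFbar ρ p.η X α k := by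
  induction k with
  | zero => rw [nodeFbar]; linarith
  | succ k ih =>
    have hX := h.mem_feasible k α
    obtain ⟨-, s, -, hs⟩ := h
    have h1 := (hs k α).descent hX ih
    have h2 := P.nodeF_succ_le hρ p.ξ X α k
    have hc0 : 0 ≤ min p.ψ ((p.ζ - p.ξ) / 2) := le_min p.ψ_pos.le (by linarith [p.ξ_le_ζ])
    have h3 : 0 ≤ p.φ * min p.ψ ((p.ζ - p.ξ) / 2) * ‖Xh k α - X k α‖ ^ 2 :=
      mul_nonneg (mul_nonneg p.φ_pos.le hc0) (sq_nonneg _)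
    have h4 : 0 ≤ p.ξ / 2 * ‖X (k + 1) α - X k α‖ ^ 2 :=
      mul_nonneg (by linarith [p.ξ_nonneg]) (sq_nonneg _)
    have h5 : P.nodeF ρ X α (k + 1) ≤ P.nodeFbar ρ p.η X α k := by linarith
    rw [nodeFbar_succ]
    have h6 := mul_le_mul_of_nonneg_left h5 (show 0 ≤ 1 - p.η by linarith [p.η_le_one])
    linarith

/-- The average moves by `η` times the difference between the new value and the old average. The
half-step displacement is paid for by `descent`, the full displacement by the proximal slack in
`nodeF_succ_le`. -/
lemma nodeFbar_decrease (h : IsRun P ρ p X Xh) (hρ : IsLossKernel ρ) (α : A) (k : ℕ) :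
    P.nodeFbar ρ p.η X α (k + 1)
      + p.decrease * (‖Xh k α - X k α‖ ^ 2 + ‖X (k + 1) α - X k α‖ ^ 2)
      ≤ P.nodeFbar ρ p.η X α k := by
  have h0 := nodeF_le_nodeFbar h hρ α k
  have hX := h.mem_feasible k α
  obtain ⟨-, s, -, hs⟩ := h
  have h1 := (hs k α).descent hX h0
  have h2 := P.nodeF_succ_le hρ p.ξ X α k
  have h3 := mul_le_mul_of_nonneg_right
    (min_le_left (p.φ * min p.ψ ((p.ζ - p.ξ) / 2)) (p.ξ / 2)) (sq_nonneg ‖Xh k α - X k α‖)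
  have h4 := mul_le_mul_of_nonneg_right
    (min_le_right (p.φ * min p.ψ ((p.ζ - p.ξ) / 2)) (p.ξ / 2)) (sq_nonneg ‖X (k + 1) α - X k α‖)
  have h5 : P.nodeF ρ X α (k + 1) + min (p.φ * min p.ψ ((p.ζ - p.ξ) / 2)) (p.ξ / 2)
      * (‖Xh k α - X k α‖ ^ 2 + ‖X (k + 1) α - X k α‖ ^ 2) ≤ P.nodeFbar ρ p.η X α k := by
    linarith
  have h6 := mul_le_mul_of_nonneg_left h5 p.η_pos.le
  rw [nodeFbar_succ, Params.decrease]
  linarith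

lemma objective_le_objectiveBar (h : IsRun P ρ p X Xh) (hρ : IsLossKernel ρ) (k : ℕ) :
    P.objective ρ (X k) ≤ P.objectiveBar ρ p.η X k := by
  rw [← P.sum_nodeF hρ, ← P.sum_nodeFbar hρ]
  exact Finset.sum_le_sum fun α _ => nodeF_le_nodeFbar h hρ α k

/-- Sufficient decrease of `F̄`. -/
lemma objectiveBar_decrease (h : IsRun P ρ p X Xh) (hρ : IsLossKernel ρ) (k : ℕ) :
    P.objectiveBar ρ p.η X (k + 1)
      + p.decrease * (‖Xh k - X k‖ ^ 2 + ‖X (k + 1) - X k‖ ^ 2) ≤ P.objectiveBar ρ p.η X k := by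
  rw [← P.sum_nodeFbar hρ, ← P.sum_nodeFbar hρ, norm_sq_eq_sum_node, norm_sq_eq_sum_node,
    ← Finset.sum_add_distrib, Finset.mul_sum, ← Finset.sum_add_distrib]
  exact Finset.sum_le_sum fun α _ => nodeFbar_decrease h hρ α k

lemma antitone_objectiveBar (h : IsRun P ρ p X Xh) (hρ : IsLossKernel ρ) :
    Antitone (P.objectiveBar ρ p.η X) := by
  refine antitone_nat_of_succ_le fun k => ?_
  have h1 := objectiveBar_decrease h hρ k
  have h2 : 0 ≤ p.decrease * (‖Xh k - X k‖ ^ 2 + ‖X (k + 1) - X k‖ ^ 2) :=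
    mul_nonneg p.decrease_nonneg (by positivity)
  linarith

lemma objectiveBar_zero (η : ℝ) : P.objectiveBar ρ η X 0 = P.objective ρ (X 0) := by
  rw [objectiveBar]; ring

lemma exists_tendsto_objective (h : IsRun P ρ p X Xh) (hρ : IsLossKernel ρ) :
    ∃ Finf : ℝ, Tendsto (fun k => P.objective ρ (X k)) atTop (𝓝 Finf) ∧
      Tendsto (P.objectiveBar ρ p.η X) atTop (𝓝 Finf) := by
  have hbar := tendsto_atTop_ciInf (antitone_objectiveBar h hρ) ⟨0, by
    rintro _ ⟨k, rfl⟩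
    exact (P.objective_nonneg hρ _).trans (objective_le_objectiveBar h hρ k)⟩
  refine ⟨_, ?_, hbar⟩
  rw [← tendsto_add_atTop_iff_nat 1]
  -- Solving the averaging recursion for the newest objective value, which is possible because `η >
  -- 0`, expresses it through two consecutive averages.
  have h1 := (hbar.comp (tendsto_add_atTop_nat 1)).sub (hbar.const_mul (1 - p.η))
  have h2 := h1.const_mul p.η⁻¹
  refine (h2.congr fun k => ?_).trans (le_of_eq ?_)
  · simp only [Function.comp_apply, objectiveBar]
    field_simp [p.η_pos.ne']
    ring
  · congr 1
    field_simp [p.η_pos.ne']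
    ring

lemma sum_sq_le (h : IsRun P ρ p X Xh) (hρ : IsLossKernel ρ) {Finf : ℝ}
    (hF : Tendsto (P.objectiveBar ρ p.η X) atTop (𝓝 Finf)) (K : ℕ) :
    p.decrease * ∑ k ∈ Finset.range K, (‖Xh k - X k‖ ^ 2 + ‖X (k + 1) - X k‖ ^ 2)
      ≤ P.objective ρ (X 0) - Finf := by
  have h1 : p.decrease * ∑ k ∈ Finset.range K, (‖Xh k - X k‖ ^ 2 + ‖X (k + 1) - X k‖ ^ 2)
      ≤ P.objective ρ (X 0) - P.objectiveBar ρ p.η X K := by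
    induction K with
    | zero => simp [objectiveBar_zero]
    | succ K ih =>
      rw [Finset.sum_range_succ, mul_add]
      linarith [objectiveBar_decrease h hρ K]
  linarith [(antitone_objectiveBar h hρ).le_of_tendsto hF K]

lemma tendsto_norm_sub (h : IsRun P ρ p X Xh) (hρ : IsLossKernel ρ) (hp : 0 < p.decrease) :
    Tendsto (fun k => ‖Xh k - X k‖) atTop (𝓝 0) ∧
      Tendsto (fun k => ‖X (k + 1) - X k‖) atTop (𝓝 0) := by
  obtain ⟨Finf, -, hF⟩ := exists_tendsto_objective h hρ
  have hs : Summable fun k => ‖Xh k - X k‖ ^ 2 + ‖X (k + 1) - X k‖ ^ 2 := by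
    refine summable_of_sum_range_le (c := (P.objective ρ (X 0) - Finf) / p.decrease)
      (fun k => by positivity) fun K => ?_
    rw [le_div_iff₀ hp, mul_comm]
    exact sum_sq_le h hρ hF K
  have h0 := hs.tendsto_atTop_zero
  have h1 : Tendsto (fun k => √(‖Xh k - X k‖ ^ 2 + ‖X (k + 1) - X k‖ ^ 2)) atTop (𝓝 0) := by
    simpa using h0.sqrt
  constructor
  · refine squeeze_zero (fun k => norm_nonneg _) (fun k => ?_) h1
    exact Real.le_sqrt_of_sq_le (by linarith [sq_nonneg ‖X (k + 1) - X k‖])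
  · refine squeeze_zero (fun k => norm_nonneg _) (fun k => ?_) h1
    exact Real.le_sqrt_of_sq_le (by linarith [sq_nonneg ‖Xh k - X k‖])

end IsRun

/-! ### Curves in the rotation group -/

-- The operator norm serves only to differentiate the exponential; the conclusion is entrywise and
-- independent of it.
open scoped Matrix.Norms.Operator in
lemma hasDerivAt_matrix_exp {d : ℕ} (M : Matrix (Fin d) (Fin d) ℝ) (a b : Fin d) :
    HasDerivAt (fun t : ℝ => NormedSpace.exp (t • M) a b) (M a b) 0 := by
  have h := hasDerivAt_exp_smul_const (𝕂 := ℝ) M 0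
  rw [zero_smul, NormedSpace.exp_zero, one_mul] at h
  exact hasDerivAt_pi.1 (hasDerivAt_pi.1 h a) b

/-- Orthogonality leaves determinant `±1`, and the sign is settled by writing the exponential as the
square of `exp (M / 2)`. -/
lemma exp_mem_SO {d : ℕ} {M : Matrix (Fin d) (Fin d) ℝ} (hM : M.transpose = -M) :
    NormedSpace.exp M ∈ Matrix.specialOrthogonalGroup (Fin d) ℝ := by
  have horth : ∀ N : Matrix (Fin d) (Fin d) ℝ, N.transpose = -N →
      NormedSpace.exp N * (NormedSpace.exp N).transpose = 1 := by
    intro N hN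
    rw [← Matrix.exp_transpose, hN, ← Matrix.exp_add_of_commute _ _ ((Commute.refl N).neg_right),
      add_neg_cancel, NormedSpace.exp_zero]
  rw [Matrix.mem_specialOrthogonalGroup_iff]
  refine ⟨(Matrix.mem_orthogonalGroup_iff (Fin d) ℝ).2 (horth M hM), ?_⟩
  have hdet : (NormedSpace.exp M).det * (NormedSpace.exp M).det = 1 := by
    have := congrArg Matrix.det (horth M hM)
    rwa [Matrix.det_mul, Matrix.det_transpose, Matrix.det_one] at this
  have hsq : NormedSpace.exp M
      = NormedSpace.exp ((1 / 2 : ℝ) • M) * NormedSpace.exp ((1 / 2 : ℝ) • M) := by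
    rw [← Matrix.exp_add_of_commute _ _ rfl, ← add_smul]
    norm_num
  have hpos : 0 ≤ (NormedSpace.exp M).det := by
    rw [hsq, Matrix.det_mul]
    exact mul_self_nonneg _
  nlinarith

lemma SO_mul_mem {d : ℕ} {Q R : Matrix (Fin d) (Fin d) ℝ}
    (hQ : Q ∈ Matrix.specialOrthogonalGroup (Fin d) ℝ)
    (hR : R ∈ Matrix.specialOrthogonalGroup (Fin d) ℝ) :
    Q * R ∈ Matrix.specialOrthogonalGroup (Fin d) ℝ := mul_mem hQ hR

lemma exists_curve_SO {d : ℕ} {R V : Matrix (Fin d) (Fin d) ℝ}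
    (hR : R ∈ Matrix.specialOrthogonalGroup (Fin d) ℝ)
    (hV : (R.transpose * V).transpose = -(R.transpose * V)) :
    ∃ c : ℝ → Matrix (Fin d) (Fin d) ℝ, c 0 = R ∧
      (∀ t, c t ∈ Matrix.specialOrthogonalGroup (Fin d) ℝ) ∧
      ∀ a b, HasDerivAt (fun t => c t a b) (V a b) 0 := by
  -- Tangency makes `Rᵀ V` skew, so the curve stays in the group; its velocity at zero is `R Rᵀ V =
  -- V`.
  refine ⟨fun t => R * NormedSpace.exp (t • (R.transpose * V)), ?_, fun t => ?_, fun a b => ?_⟩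
  · simp [NormedSpace.exp_zero]
  · exact SO_mul_mem hR (exp_mem_SO (by rw [Matrix.transpose_smul, hV, smul_neg]))
  · have h : V a b = ∑ j, R a j * (R.transpose * V) j b := by
      rw [← Matrix.mul_apply, ← Matrix.mul_assoc, mul_transpose_of_mem_SO hR, Matrix.one_mul]
    rw [h]
    simp only [Matrix.mul_apply (M := R)]
    exact HasDerivAt.fun_sum fun j _ => (hasDerivAt_matrix_exp _ j b).const_mul _

/-! ### Curves in the feasible set -/

lemma hasDerivAt_piLp {ι : Type*} [Fintype ι] {E : ι → Type*} [∀ i, NormedAddCommGroup (E i)]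
    [∀ i, NormedSpace ℝ (E i)] {c : ℝ → PiLp 2 E} {v : PiLp 2 E} {t : ℝ}
    (h : ∀ i, HasDerivAt (fun s => c s i) (v i) t) : HasDerivAt c v t := by
  have h' : HasFDerivAt c (ContinuousLinearMap.toSpanSingleton ℝ v) t := by
    rw [← hasFDerivWithinAt_univ, hasFDerivWithinAt_piLp]
    intro i
    rw [hasFDerivWithinAt_univ]
    refine (h i).hasFDerivAt.congr_fderiv ?_
    ext
    simp
  simpa using h'.hasDerivAt

lemma exists_curve_pose {d : ℕ} {x V : Pose d}
    (hx : rotat x ∈ Matrix.specialOrthogonalGroup (Fin d) ℝ)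
    (hV : ((rotat x).transpose * rotat V).transpose = -((rotat x).transpose * rotat V)) :
    ∃ c : ℝ → Pose d, c 0 = x ∧
      (∀ t, rotat (c t) ∈ Matrix.specialOrthogonalGroup (Fin d) ℝ) ∧ HasDerivAt c V 0 := by
  obtain ⟨c, h0, hc, hd⟩ := exists_curve_SO hx hV
  refine ⟨fun t => mkPose (transl x + t • transl V) (c t), ?_, hc, ?_⟩
  · simp [h0]
  · refine hasDerivAt_piLp ?_
    rintro ⟨a, b⟩
    refine Fin.cases ?_ (fun b => ?_) b
    · have : HasDerivAt (fun t : ℝ => transl x a + t * transl V a) (1 * transl V a) 0 :=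
        ((hasDerivAt_id (0 : ℝ)).mul_const _).const_add _
      rw [one_mul] at this
      exact this
    · exact hd a b

lemma exists_curve_piLp {ι E : Type*} [Fintype ι] [NormedAddCommGroup E] [NormedSpace ℝ E]
    {x V : PiLp 2 fun _ : ι => E} {S : Set E}
    (h : ∀ i, ∃ c : ℝ → E, c 0 = x i ∧ (∀ t, c t ∈ S) ∧ HasDerivAt c (V i) 0) :
    ∃ c : ℝ → PiLp 2 fun _ : ι => E, c 0 = x ∧ (∀ t i, c t i ∈ S) ∧ HasDerivAt c V 0 := by
  choose c h0 hc hd using h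
  refine ⟨fun t => WithLp.toLp 2 fun i => c i t, ?_, fun t i => hc i t, hasDerivAt_piLp hd⟩
  ext1 i
  exact h0 i

/-- First-order condition along a curve for a function that is majorized by a linear function plus
a multiple of the squared distance. -/
lemma eq_zero_of_curve {E : Type*} [NormedAddCommGroup E] [InnerProductSpace ℝ E]
    [FiniteDimensional ℝ E] {l : E → ℝ} (hl : IsLinearMap ℝ l) (C : ℝ) {c : ℝ → E} {x V : E} (h0 : c 0 = x) (hc : HasDerivAt c V 0)
    (h : ∀ t, 0 ≤ l (c t - x) + C * ‖c t - x‖ ^ 2) : l V = 0 := by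
  have h1 : HasDerivAt (fun t => c t - x) V 0 := hc.sub_const x
  have h2 : HasDerivAt (fun t => l (c t - x) + C * ‖c t - x‖ ^ 2) (l V + C * (2 * 0)) 0 := by
    refine ((LinearMap.toContinuousLinearMap hl.mk').hasFDerivAt.comp_hasDerivAt 0 h1).add ?_
    have h3 := (h1.norm_sq).const_mul C
    rw [h0, sub_self, inner_zero_left] at h3
    exact h3
  -- The function is nonnegative and vanishes at `t = 0`, while the quadratic term has zero
  -- derivative there.
  have h3 : IsLocalMin (fun t => l (c t - x) + C * ‖c t - x‖ ^ 2) 0 :=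
    Eventually.of_forall fun t => by simpa [h0, hl.map_zero] using h t
  simpa using h3.hasDerivAt_eq_zero h2

/-! ### Optimality conditions of the surrogate `H` -/

namespace PoseGraph

variable (P : PoseGraph d n) {ρ : ℝ → ℝ}

/-- The bilinear form of `Π^α`. -/
def bilinPi (ρ : ℝ → ℝ) (ζ : ℝ) (X : Conf d n) (α : A) (x y : NodeConf d (n α)) : ℝ :=
  ∑ e ∈ P.intraEdges, P.bilinOmega e (embed α x) (embed α y)
    + ∑ e ∈ P.interEdges, P.weight ρ e X * P.bilinOmega e (embed α x) (embed α y)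
    + ζ * inner ℝ x y

lemma bilinOmega_add_right (e : Vertex n × Vertex n) (X Y Z : Conf d n) :
    P.bilinOmega e X (Y + Z) = P.bilinOmega e X Y + P.bilinOmega e X Z := by
  simp only [bilinOmega, map_add, inner_add_right]; ring

lemma bilinOmega_smul_right (e : Vertex n × Vertex n) (c : ℝ) (X Y : Conf d n) :
    P.bilinOmega e X (c • Y) = c * P.bilinOmega e X Y := by
  simp only [bilinOmega, map_smul, real_inner_smul_right]; ring

lemma bilinPi_add_right (ζ : ℝ) (X : Conf d n) (α : A) (x y z : NodeConf d (n α)) :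
    P.bilinPi ρ ζ X α x (y + z) = P.bilinPi ρ ζ X α x y + P.bilinPi ρ ζ X α x z := by
  simp only [bilinPi, embed_add, bilinOmega_add_right, inner_add_right, mul_add,
    Finset.sum_add_distrib]
  ring

lemma bilinPi_smul_right (ζ : ℝ) (X : Conf d n) (α : A) (c : ℝ) (x y : NodeConf d (n α)) :
    P.bilinPi ρ ζ X α x (c • y) = c * P.bilinPi ρ ζ X α x y := by
  simp only [bilinPi, embed_smul, bilinOmega_smul_right, real_inner_smul_right, mul_add,
    Finset.mul_sum, mul_left_comm]

lemma sqPi_add (ζ : ℝ) (X : Conf d n) (α : A) (x y : NodeConf d (n α)) :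
    P.sqPi ρ ζ X α (x + y)
      = P.sqPi ρ ζ X α x + 2 * P.bilinPi ρ ζ X α x y + P.sqPi ρ ζ X α y := by
  have h1 : ∑ e ∈ P.intraEdges, P.sqOmega e (embed α (x + y)) = ∑ e ∈ P.intraEdges,
      (P.sqOmega e (embed α x) + 2 * P.bilinOmega e (embed α x) (embed α y)
        + P.sqOmega e (embed α y)) :=
    Finset.sum_congr rfl fun e he => by
      rw [embed_add, P.sqOmega_add (mem_edges_of_mem_intraEdges he)]
  have h2 : ∑ e ∈ P.interEdges, P.weight ρ e X * P.sqOmega e (embed α (x + y))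
      = ∑ e ∈ P.interEdges, (P.weight ρ e X * P.sqOmega e (embed α x)
        + 2 * (P.weight ρ e X * P.bilinOmega e (embed α x) (embed α y))
        + P.weight ρ e X * P.sqOmega e (embed α y)) :=
    Finset.sum_congr rfl fun e he => by
      rw [embed_add, P.sqOmega_add (mem_edges_of_mem_interEdges he)]; ring
  simp only [sqPi, bilinPi, h1, h2, Finset.sum_add_distrib, norm_add_sq_real, ← Finset.mul_sum]
  ring

lemma sqPi_eq_bilinPi (ζ : ℝ) (X : Conf d n) (α : A) (x : NodeConf d (n α)) :
    P.sqPi ρ ζ X α x = P.bilinPi ρ ζ X α x x := by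
  rw [sqPi, bilinPi, real_inner_self_eq_norm_sq]
  congr 2
  · exact Finset.sum_congr rfl fun e he =>
      P.sqOmega_eq_bilinOmega (mem_edges_of_mem_intraEdges he) _
  · exact Finset.sum_congr rfl fun e he => by
      rw [P.sqOmega_eq_bilinOmega (mem_edges_of_mem_interEdges he)]

/-- The bound does not depend on `X`, again because weights lie in `[0, 1]`; this keeps the final
constant uniform over all runs. -/
lemma abs_bilinPi_le (hρ : IsLossKernel ρ) {ζ : ℝ} (hζ : 0 ≤ ζ) (X : Conf d n) (α : A)
    (x y : NodeConf d (n α)) :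
    |P.bilinPi ρ ζ X α x y| ≤ (P.omegaBound + ζ) * (‖x‖ * ‖y‖) := by
  have hb : ∀ e, |P.bilinOmega e (embed α x) (embed α y)|
      ≤ 2 * (‖P.headMap e‖ ^ 2 + ‖P.tailMap e‖ ^ 2) * (‖x‖ * ‖y‖) := fun e => by
    have := P.abs_bilinOmega_le e (embed α x) (embed α y)
    rwa [norm_embed, norm_embed] at this
  have h1 : |∑ e ∈ P.intraEdges, P.bilinOmega e (embed α x) (embed α y)|
      ≤ ∑ e ∈ P.intraEdges, 2 * (‖P.headMap e‖ ^ 2 + ‖P.tailMap e‖ ^ 2) * (‖x‖ * ‖y‖) :=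
    (Finset.abs_sum_le_sum_abs _ _).trans (Finset.sum_le_sum fun e _ => hb e)
  have h2 : |∑ e ∈ P.interEdges, P.weight ρ e X * P.bilinOmega e (embed α x) (embed α y)|
      ≤ ∑ e ∈ P.interEdges, 2 * (‖P.headMap e‖ ^ 2 + ‖P.tailMap e‖ ^ 2) * (‖x‖ * ‖y‖) := by
    refine (Finset.abs_sum_le_sum_abs _ _).trans (Finset.sum_le_sum fun e he => ?_)
    have he := mem_edges_of_mem_interEdges he
    rw [abs_mul, abs_of_nonneg (P.weight_nonneg hρ he X)]
    exact (mul_le_of_le_one_left (abs_nonneg _) (P.weight_le_one hρ he X)).trans (hb e)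
  have h3 : |ζ * inner ℝ x y| ≤ ζ * (‖x‖ * ‖y‖) := by
    rw [abs_mul, abs_of_nonneg hζ]
    exact mul_le_mul_of_nonneg_left (abs_real_inner_le_norm _ _) hζ
  rw [bilinPi, omegaBound, add_mul, Finset.sum_mul, sum_edges]
  exact (abs_add_le _ _).trans (add_le_add ((abs_add_le _ _).trans (add_le_add h1 h2)) h3)

lemma nodeH_add (ζ : ℝ) (X Z : Conf d n) (α : A) (x w : NodeConf d (n α)) :
    P.nodeH ρ ζ X Z α (x + w) = P.nodeH ρ ζ X Z α x + (P.bilinPi ρ ζ X α (x - Z α) w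
      + inner ℝ (gradient (P.objective ρ) Z α) w) + 1 / 2 * P.sqPi ρ ζ X α w := by
  rw [nodeH, nodeH, add_sub_right_comm, P.sqPi_add, inner_add_right]
  ring

/-- The Riemannian first-order condition for minimizers of `H^α(· | Z)`. -/
lemma IsArgminH.first_order {P : PoseGraph d n} (hρ : IsLossKernel ρ) {ζ : ℝ} (hζ : 0 ≤ ζ)
    {X Z : Conf d n} {α : A} {x V : NodeConf d (n α)} (h : P.IsArgminH ρ ζ X Z α x)
    (hV : ∀ i, ((rotat (x i)).transpose * rotat (V i)).transpose
      = -((rotat (x i)).transpose * rotat (V i))) :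
    P.bilinPi ρ ζ X α (x - Z α) V + inner ℝ (gradient (P.objective ρ) Z α) V = 0 := by
  obtain ⟨c, h0, hc, hd⟩ := exists_curve_piLp
    (S := {y : Pose d | rotat y ∈ Matrix.specialOrthogonalGroup (Fin d) ℝ})
    fun i => exists_curve_pose (h.1 i) (hV i)
  have hlin : IsLinearMap ℝ fun w => P.bilinPi ρ ζ X α (x - Z α) w
      + inner ℝ (gradient (P.objective ρ) Z α) w := by
    constructor
    · intro y z
      rw [P.bilinPi_add_right, inner_add_right]; ring
    · intro r y
      rw [P.bilinPi_smul_right, real_inner_smul_right, smul_eq_mul]; ring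
  refine eq_zero_of_curve hlin (P.omegaBound + ζ) h0 hd
    fun t => ?_
  have h1 := h.2 _ (hc t)
  have h2 := P.nodeH_add (ρ := ρ) ζ X Z α x (c t - x)
  rw [add_sub_cancel] at h2
  have h3 := (le_abs_self _).trans (P.abs_bilinPi_le hρ hζ X α (c t - x) (c t - x))
  rw [← P.sqPi_eq_bilinPi] at h3
  have h4 : 0 ≤ (P.omegaBound + ζ) * (‖c t - x‖ * ‖c t - x‖) :=
    mul_nonneg (add_nonneg P.omegaBound_nonneg hζ) (mul_self_nonneg _)
  rw [sq]
  linarith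

end PoseGraph

/-! ### Riemannian gradients -/

lemma rgrad_mem (F : Conf d n → ℝ) (X : Conf d n) : rgrad F X ∈ tangentSpace X :=
  Submodule.starProjection_apply_mem _ _

lemma inner_rgrad (F : Conf d n → ℝ) {X V : Conf d n} (hV : V ∈ tangentSpace X) :
    inner ℝ (rgrad F X) V = inner ℝ (gradient F X) V := by
  rw [rgrad, Submodule.inner_starProjection_left_eq_right,
    Submodule.starProjection_eq_self_iff.2 hV]

lemma norm_rgrad_sq (F : Conf d n → ℝ) (X : Conf d n) :
    ‖rgrad F X‖ ^ 2 = inner ℝ (gradient F X) (rgrad F X) := by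
  rw [← inner_rgrad F (rgrad_mem F X), real_inner_self_eq_norm_sq]

/-- Transport of tangent vectors between two feasible points. -/
lemma exists_transport {X Y V : Conf d n} (hX : X ∈ feasible d n) (hY : Y ∈ feasible d n)
    (hV : V ∈ tangentSpace X) : ∃ W ∈ tangentSpace Y, ‖W - V‖ ≤ ‖Y - X‖ * ‖V‖ := by
  -- The skew matrix `R_Xᵀ V` is kept and only the base rotation is changed. The rotation part of `W
  -- - V` is then `(R_Y - R_X) R_Xᵀ V`, and the translation parts agree.
  refine ⟨WithLp.toLp 2 fun α => WithLp.toLp 2 fun i => mkPose (transl (V α i))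
    (rotat (Y α i) * ((rotat (X α i)).transpose * rotat (V α i))), fun α i => ?_, ?_⟩
  · change ((rotat (Y α i)).transpose * rotat (mkPose (transl (V α i))
      (rotat (Y α i) * ((rotat (X α i)).transpose * rotat (V α i))))).transpose
      = -((rotat (Y α i)).transpose * rotat (mkPose (transl (V α i))
      (rotat (Y α i) * ((rotat (X α i)).transpose * rotat (V α i)))))
    rw [rotat_mkPose, ← Matrix.mul_assoc (rotat (Y α i)).transpose, transpose_mul_of_mem_SO (hY α i),
      Matrix.one_mul]
    exact hV α i
  · rw [← sq_le_sq₀ (norm_nonneg _) (by positivity), mul_pow, norm_sq_eq_sum_node,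
      norm_sq_eq_sum_node V, Finset.mul_sum]
    refine Finset.sum_le_sum fun α _ => ?_
    rw [PiLp.norm_sq_eq_of_L2 _ (V α), PiLp.norm_sq_eq_of_L2 (fun _ => Pose d) (_ : NodeConf d (n α)),
      Finset.mul_sum]
    refine Finset.sum_le_sum fun i _ => ?_
    change ‖mkPose (transl (V α i)) (rotat (Y α i) * ((rotat (X α i)).transpose * rotat (V α i)))
      - V α i‖ ^ 2 ≤ ‖Y - X‖ ^ 2 * ‖V α i‖ ^ 2
    have hrot : rotat (mkPose (transl (V α i))
        (rotat (Y α i) * ((rotat (X α i)).transpose * rotat (V α i))) - V α i)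
        = rotat (Y α i - X α i) * ((rotat (X α i)).transpose * rotat (V α i)) := by
      rw [rotat_sub, rotat_sub, rotat_mkPose, Matrix.sub_mul, ← Matrix.mul_assoc (rotat (X α i)),
        mul_transpose_of_mem_SO (hX α i), Matrix.one_mul]
    rw [norm_sq_pose, hrot, transl_sub, transl_mkPose, sub_self]
    have h0 : vecSq (0 : Fin d → ℝ) = 0 := by simp [vecSq]
    have h1 := frobSq_mul_le (rotat (Y α i - X α i)) ((rotat (X α i)).transpose * rotat (V α i))
    rw [frobSq_SO_transpose_mul _ (hX α i)] at h1
    have h2 : frobSq (rotat (Y α i - X α i)) ≤ ‖Y - X‖ ^ 2 := by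
      have h3 : frobSq (rotat (Y α i - X α i)) ≤ ‖Y α i - X α i‖ ^ 2 := by
        rw [norm_sq_pose]; exact le_add_of_nonneg_left (vecSq_nonneg _)
      have h4 : ‖Y α i - X α i‖ ≤ ‖Y - X‖ :=
        (PiLp.norm_apply_le ((Y - X) α) i).trans (norm_node_le (Y - X) α)
      exact h3.trans (pow_le_pow_left₀ (norm_nonneg _) h4 2)
    have h5 : frobSq (rotat (V α i)) ≤ ‖V α i‖ ^ 2 := by
      rw [norm_sq_pose]; exact le_add_of_nonneg_left (vecSq_nonneg _)
    rw [h0, zero_add]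
    exact h1.trans (mul_le_mul h2 h5 (frobSq_nonneg _) (sq_nonneg _))

lemma le_of_sq_le_mul {a b : ℝ} (ha : 0 ≤ a) (hb : 0 ≤ b) (h : a ^ 2 ≤ b * a) : a ≤ b := by
  rcases ha.eq_or_lt with rfl | ha
  · exact hb
  · exact le_of_mul_le_mul_right (by rwa [← sq]) ha

/-- The Riemannian gradient at a feasible point compared with the one at a nearby point. -/
lemma norm_rgrad_le (F : Conf d n → ℝ) {X Y : Conf d n} (hX : X ∈ feasible d n)
    (hY : Y ∈ feasible d n) : ‖rgrad F X‖ ≤ ‖gradient F X‖ * ‖Y - X‖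
      + (‖gradient F X - gradient F Y‖ + ‖rgrad F Y‖) * (1 + ‖Y - X‖) := by
  obtain ⟨W, hW, hWV⟩ := exists_transport hX hY (rgrad_mem F X)
  generalize hV : rgrad F X = V at hWV
  have hWn : ‖W‖ ≤ (1 + ‖Y - X‖) * ‖V‖ := by
    have : ‖W‖ ≤ ‖W - V‖ + ‖V‖ := by simpa using norm_add_le (W - V) V
    linarith
  -- The three terms are the transport error, the change of the Euclidean gradient, and the
  -- Riemannian gradient at `Y` tested on a vector tangent there.
  have hsq : ‖V‖ ^ 2 = -inner ℝ (gradient F X) (W - V)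
      + inner ℝ (gradient F X - gradient F Y) W + inner ℝ (rgrad F Y) W := by
    have := norm_rgrad_sq F X
    rw [hV] at this
    rw [inner_rgrad F hW, inner_sub_left, inner_sub_right, this]
    ring
  have h1 : -inner ℝ (gradient F X) (W - V) ≤ ‖gradient F X‖ * (‖Y - X‖ * ‖V‖) :=
    (neg_le_abs _).trans ((abs_real_inner_le_norm _ _).trans
      (mul_le_mul_of_nonneg_left hWV (norm_nonneg _)))
  have h2 : inner ℝ (gradient F X - gradient F Y) W
      ≤ ‖gradient F X - gradient F Y‖ * ((1 + ‖Y - X‖) * ‖V‖) :=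
    (real_inner_le_norm _ _).trans (mul_le_mul_of_nonneg_left hWn (norm_nonneg _))
  have h3 : inner ℝ (rgrad F Y) W ≤ ‖rgrad F Y‖ * ((1 + ‖Y - X‖) * ‖V‖) :=
    (real_inner_le_norm _ _).trans (mul_le_mul_of_nonneg_left hWn (norm_nonneg _))
  refine le_of_sq_le_mul (norm_nonneg _) (add_nonneg (mul_nonneg (norm_nonneg _) (norm_nonneg _))
    (mul_nonneg (add_nonneg (norm_nonneg _) (norm_nonneg _))
      (add_nonneg zero_le_one (norm_nonneg _)))) ?_
  linarith

/-- The Riemannian gradient at a point whose blocks minimize `H^α(· | Z)` for points `Z` near it. -/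
lemma norm_rgrad_le_of_isArgminH {P : PoseGraph d n} {ρ : ℝ → ℝ} (hρ : IsLossKernel ρ) {ζ : ℝ}
    (hζ : 0 ≤ ζ) {C : ℝ} (hC0 : 0 ≤ C) (hC : ∀ X Y : Conf d n,
      ‖gradient (P.objective ρ) X - gradient (P.objective ρ) Y‖ ≤ C * ‖X - Y‖)
    {X H : Conf d n} {D : ℝ} (hD : 0 ≤ D)
    (h : ∀ α, ∃ Z : Conf d n, ‖H - Z‖ ≤ D ∧ P.IsArgminH ρ ζ X Z α (H α)) :
    ‖rgrad (P.objective ρ) H‖ ≤ Fintype.card A * (C + P.omegaBound + ζ) * D := by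
  have hB := P.omegaBound_nonneg
  have hVm := rgrad_mem (P.objective ρ) H
  have hsq := norm_rgrad_sq (P.objective ρ) H
  generalize rgrad (P.objective ρ) H = V at hVm hsq
  refine le_of_sq_le_mul (norm_nonneg _)
    (mul_nonneg (mul_nonneg (Nat.cast_nonneg _) (add_nonneg (add_nonneg hC0 hB) hζ)) hD) ?_
  rw [hsq, inner_eq_sum_node]
  have hα : ∀ α : A, inner ℝ (gradient (P.objective ρ) H α) (V α)
      ≤ (C + P.omegaBound + ζ) * D * ‖V‖ := by
    intro α
    obtain ⟨Z, hZ, hmin⟩ := h α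
    have h1 := hmin.first_order hρ hζ (V := V α) (hVm α)
    -- Stationarity trades the gradient at `Z` for a bilinear term in `H - Z`. Both remaining terms
    -- are then of order `D`.
    have h2 : inner ℝ (gradient (P.objective ρ) H α) (V α)
        = inner ℝ ((gradient (P.objective ρ) H - gradient (P.objective ρ) Z) α) (V α)
          - P.bilinPi ρ ζ X α (H α - Z α) (V α) := by
      rw [PiLp.sub_apply, inner_sub_left]; linarith
    have h3 : inner ℝ ((gradient (P.objective ρ) H - gradient (P.objective ρ) Z) α) (V α)
        ≤ C * D * ‖V‖ :=
      (real_inner_le_norm _ _).trans (mul_le_mul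
        ((norm_node_le _ α).trans ((hC H Z).trans (mul_le_mul_of_nonneg_left hZ hC0)))
        (norm_node_le V α) (norm_nonneg _) (mul_nonneg hC0 hD))
    have h4 : -P.bilinPi ρ ζ X α (H α - Z α) (V α) ≤ (P.omegaBound + ζ) * (D * ‖V‖) :=
      (neg_le_abs _).trans ((P.abs_bilinPi_le hρ hζ X α _ _).trans
        (mul_le_mul_of_nonneg_left (mul_le_mul ((norm_node_le (H - Z) α).trans hZ)
          (norm_node_le V α) (norm_nonneg _) hD) (add_nonneg hB hζ)))
    linarith
  refine (Finset.sum_le_sum fun α _ => hα α).trans (le_of_eq ?_)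
  rw [Finset.sum_const, Finset.card_univ, nsmul_eq_mul]
  ring

namespace IsRun

variable {P : PoseGraph d n} {ρ : ℝ → ℝ} {p : Params} {X Xh : ℕ → Conf d n}

/-! ### Gradients along a run -/

lemma exists_norm_rgrad_half_le (P : PoseGraph d n) {ρ : ℝ → ℝ} (hρ : IsLossKernel ρ)
    (p : Params) : ∃ B : ℝ, 0 ≤ B ∧ ∀ X Xh : ℕ → Conf d n, IsRun P ρ p X Xh → ∀ k,
      ‖rgrad (P.objective ρ) (Xh k)‖ ≤ B * (‖Xh k - X k‖ + ‖X k - X (k - 1)‖) := by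
  obtain ⟨C, hC0, hC⟩ := P.exists_lipschitz_gradient_objective hρ
  have hζ : 0 ≤ p.ζ := p.ξ_nonneg.trans p.ξ_le_ζ
  refine ⟨Fintype.card A * (C + P.omegaBound + p.ζ), mul_nonneg (Nat.cast_nonneg _)
    (add_nonneg (add_nonneg hC0 P.omegaBound_nonneg) hζ), fun X Xh h k => ?_⟩
  refine norm_rgrad_le_of_isArgminH hρ hζ hC0 hC (X := X k)
    (add_nonneg (norm_nonneg _) (norm_nonneg _)) fun α => ?_
  obtain ⟨Z, hZ, hmin⟩ := h.exists_isArgminH k α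
  refine ⟨Z, ?_, hmin⟩
  have h1 := norm_sub_le_norm_sub_add_norm_sub (Xh k) (X k) Z
  rw [norm_sub_rev (X k) Z] at h1
  exact h1.trans (add_le_add_right hZ _)

/-- The backward displacements are the forward ones shifted by one index, with a zero term at `k =
0`, so both kinds are controlled by the telescoped sum; the factor two comes from `(a + b)² ≤ 2 (a²
+ b²)`. -/
lemma sum_rgrad_half_sq_le (h : IsRun P ρ p X Xh) (hρ : IsLossKernel ρ) {B : ℝ}
    (hB : ∀ k, ‖rgrad (P.objective ρ) (Xh k)‖ ≤ B * (‖Xh k - X k‖ + ‖X k - X (k - 1)‖))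
    {Finf : ℝ} (hF : Tendsto (P.objectiveBar ρ p.η X) atTop (𝓝 Finf)) (K : ℕ) :
    p.decrease * ∑ k ∈ Finset.range K, ‖rgrad (P.objective ρ) (Xh k)‖ ^ 2
      ≤ 2 * B ^ 2 * (P.objective ρ (X 0) - Finf) := by
  have h1 : ∑ k ∈ Finset.range K, ‖X k - X (k - 1)‖ ^ 2
      ≤ ∑ k ∈ Finset.range K, ‖X (k + 1) - X k‖ ^ 2 := by
    cases K with
    | zero => simp
    | succ K =>
      rw [Finset.sum_range_succ', Finset.sum_range_succ]
      simp
  have h2 : ∑ k ∈ Finset.range K, ‖rgrad (P.objective ρ) (Xh k)‖ ^ 2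
      ≤ 2 * B ^ 2 * ∑ k ∈ Finset.range K, (‖Xh k - X k‖ ^ 2 + ‖X k - X (k - 1)‖ ^ 2) := by
    rw [Finset.mul_sum]
    refine Finset.sum_le_sum fun k _ => ?_
    refine (pow_le_pow_left₀ (norm_nonneg _) (hB k) 2).trans ?_
    rw [mul_pow, mul_comm 2 (B ^ 2), mul_assoc]
    exact mul_le_mul_of_nonneg_left add_sq_le (sq_nonneg B)
  have h3 := sum_sq_le h hρ hF K
  rw [Finset.sum_add_distrib] at h2 h3
  have h4 : ∑ k ∈ Finset.range K, ‖rgrad (P.objective ρ) (Xh k)‖ ^ 2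
      ≤ 2 * B ^ 2 * (∑ k ∈ Finset.range K, ‖Xh k - X k‖ ^ 2
        + ∑ k ∈ Finset.range K, ‖X (k + 1) - X k‖ ^ 2) :=
    h2.trans (mul_le_mul_of_nonneg_left (add_le_add_right h1 _) (by positivity))
  calc _ ≤ p.decrease * (2 * B ^ 2 * (∑ k ∈ Finset.range K, ‖Xh k - X k‖ ^ 2
        + ∑ k ∈ Finset.range K, ‖X (k + 1) - X k‖ ^ 2)) :=
        mul_le_mul_of_nonneg_left h4 p.decrease_nonneg
    _ = 2 * B ^ 2 * (p.decrease * (∑ k ∈ Finset.range K, ‖Xh k - X k‖ ^ 2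
        + ∑ k ∈ Finset.range K, ‖X (k + 1) - X k‖ ^ 2)) := by ring
    _ ≤ _ := mul_le_mul_of_nonneg_left h3 (by positivity)

lemma exists_norm_rgrad_half_le_sqrt (h : IsRun P ρ p X Xh) (hρ : IsLossKernel ρ)
    (hp : 0 < p.decrease) {B : ℝ}
    (hB : ∀ k, ‖rgrad (P.objective ρ) (Xh k)‖ ≤ B * (‖Xh k - X k‖ + ‖X k - X (k - 1)‖))
    {Finf : ℝ} (hF : Tendsto (P.objectiveBar ρ p.η X) atTop (𝓝 Finf)) {K : ℕ} (hK : 1 ≤ K) :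
    ∃ k < K, ‖rgrad (P.objective ρ) (Xh k)‖ ≤ 2 * √(1 / (p.decrease / (B ^ 2 + 1))
      * ((P.objective ρ (X 0) - Finf) / ((K : ℝ) + 1))) := by
  have hQ : 0 ≤ P.objective ρ (X 0) - Finf := by simpa using sum_sq_le h hρ hF 0
  have hsum := sum_rgrad_half_sq_le h hρ hB hF K
  generalize P.objective ρ (X 0) - Finf = Q at hQ hsum
  by_contra! hlt
  set q := 1 / (p.decrease / (B ^ 2 + 1)) * (Q / ((K : ℝ) + 1)) with hq
  have hK' : (1 : ℝ) ≤ K := by exact_mod_cast hK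
  have hq0 : 0 ≤ q := by positivity
  have h1 : ∑ k ∈ Finset.range K, 4 * q
      < ∑ k ∈ Finset.range K, ‖rgrad (P.objective ρ) (Xh k)‖ ^ 2 := by
    refine Finset.sum_lt_sum_of_nonempty (Finset.nonempty_range_iff.2 (by omega)) fun k hk => ?_
    have h2 := pow_lt_pow_left₀ (hlt k (Finset.mem_range.1 hk)) (by positivity) two_ne_zero
    rw [mul_pow, Real.sq_sqrt hq0] at h2
    linarith
  rw [Finset.sum_const, Finset.card_range, nsmul_eq_mul] at h1
  have h2 := mul_lt_mul_of_pos_left h1 hp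
  have h3 : p.decrease * (K * (4 * q)) = 4 * (B ^ 2 + 1) * Q * (K / (K + 1)) := by
    rw [hq]; field_simp
  -- Having `K + 1` rather than `K` in the denominator costs at most a factor two. The factor `4 =
  -- 2²` absorbs this loss and the two in `2 * B ^ 2`.
  have h4 : (1 / 2 : ℝ) ≤ K / (K + 1) := by
    rw [div_le_div_iff₀ two_pos (by linarith)]; linarith
  have h5 : 4 * (B ^ 2 + 1) * Q * (1 / 2) ≤ 4 * (B ^ 2 + 1) * Q * (K / (K + 1)) :=
    mul_le_mul_of_nonneg_left h4 (by positivity)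
  linarith

lemma tendsto_rgrad_half (h : IsRun P ρ p X Xh) (hρ : IsLossKernel ρ) (hp : 0 < p.decrease) :
    Tendsto (fun k => rgrad (P.objective ρ) (Xh k)) atTop (𝓝 0) := by
  obtain ⟨B, -, hB⟩ := exists_norm_rgrad_half_le P hρ p
  obtain ⟨h1, h2⟩ := tendsto_norm_sub h hρ hp
  have h3 : Tendsto (fun k => ‖X k - X (k - 1)‖) atTop (𝓝 0) := by
    rw [← tendsto_add_atTop_iff_nat 1]
    exact h2
  have h4 := (h1.add h3).const_mul B
  rw [add_zero, mul_zero] at h4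
  exact squeeze_zero_norm (hB X Xh h) h4

lemma tendsto_rgrad (h : IsRun P ρ p X Xh) (hρ : IsLossKernel ρ) (hp : 0 < p.decrease) :
    Tendsto (fun k => rgrad (P.objective ρ) (X k)) atTop (𝓝 0) := by
  obtain ⟨C, -, hC⟩ := P.exists_lipschitz_gradient_objective hρ
  have h1 := (tendsto_norm_sub h hρ hp).1
  have h2 := (tendsto_rgrad_half h hρ hp).norm
  -- Translations are unbounded, so compactness is not available; the gradient is bounded because
  -- the objective never exceeds its initial value.
  have hG : ∀ k, ‖gradient (P.objective ρ) (X k)‖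
      ≤ √(2 * (P.omegaBound + 1) * P.objective ρ (X 0)) := by
    intro k
    refine Real.le_sqrt_of_sq_le ((P.norm_gradient_objective_sq_le hρ _).trans ?_)
    refine mul_le_mul_of_nonneg_left ?_ (by linarith [P.omegaBound_nonneg])
    rw [← objectiveBar_zero (P := P) (ρ := ρ) (X := X) p.η]
    exact (objective_le_objectiveBar h hρ k).trans (antitone_objectiveBar h hρ (Nat.zero_le k))
  have h3 := (h1.const_mul √(2 * (P.omegaBound + 1) * P.objective ρ (X 0))).add
    (((h1.const_mul C).add h2).mul (h1.const_add 1))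
  rw [norm_zero, mul_zero, mul_zero, add_zero, zero_mul, add_zero] at h3
  refine squeeze_zero_norm (fun k => ?_) h3
  refine (norm_rgrad_le (P.objective ρ) (h.mem_feasible k) (h.half_mem_feasible k)).trans ?_
  have h4 := hC (X k) (Xh k)
  rw [norm_sub_rev (X k) (Xh k)] at h4
  exact add_le_add (mul_le_mul_of_nonneg_right (hG k) (norm_nonneg _))
    (mul_le_mul_of_nonneg_right (add_le_add_left h4 _) (add_nonneg zero_le_one (norm_nonneg _)))

end IsRun
end
end DistPGO

theorem mainTheorem1 {A : Type*} [Fintype A] [DecidableEq A] {d : ℕ} {n : A → ℕ}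
    (P : PoseGraph d n) (ρ : ℝ → ℝ) (hρ : IsLossKernel ρ) (p : Params) :
    ∃ ε : ℝ, 0 < ε ∧ ∀ X Xh : ℕ → Conf d n, IsRun P ρ p X Xh →
      Antitone (P.objectiveBar ρ p.η X) ∧
      ∃ Finf : ℝ,
        Tendsto (fun k => P.objective ρ (X k)) atTop (𝓝 Finf) ∧
        Tendsto (P.objectiveBar ρ p.η X) atTop (𝓝 Finf) ∧
        (p.ζ > p.ξ → p.ξ > 0 →
          Tendsto (fun k => ‖X (k + 1) - X k‖) atTop (𝓝 0) ∧
          Tendsto (fun k => ‖Xh k - X k‖) atTop (𝓝 0) ∧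
          (∀ K : ℕ, 1 ≤ K → ∃ k < K,
            ‖rgrad (P.objective ρ) (Xh k)‖
              ≤ 2 * √(1 / ε * ((P.objective ρ (X 0) - Finf) / ((K : ℝ) + 1)))) ∧
          Tendsto (fun k => rgrad (P.objective ρ) (X k)) atTop (𝓝 0) ∧
          Tendsto (fun k => rgrad (P.objective ρ) (Xh k)) atTop (𝓝 0)) := by
  obtain ⟨B, -, hB⟩ := IsRun.exists_norm_rgrad_half_le P hρ p
  -- The constant is fixed before any run. If `decrease` is zero, the rate is not asserted and any
  -- positive value will do; the `+ 1` avoids division by zero when `B = 0`.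
  have hε : ∃ ε : ℝ, 0 < ε ∧ (0 < p.decrease → ε = p.decrease / (B ^ 2 + 1)) := by
    by_cases hp : 0 < p.decrease
    · exact ⟨_, by positivity, fun _ => rfl⟩
    · exact ⟨1, one_pos, fun h => absurd h hp⟩
  obtain ⟨ε, hε0, hε⟩ := hε
  refine ⟨ε, hε0, fun X Xh h => ⟨h.antitone_objectiveBar hρ, ?_⟩⟩
  obtain ⟨Finf, hF, hFbar⟩ := h.exists_tendsto_objective hρ
  refine ⟨Finf, hF, hFbar, fun h1 h2 => ?_⟩
  have hp := p.decrease_pos h1 h2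
  have ht := h.tendsto_norm_sub hρ hp
  refine ⟨ht.2, ht.1, fun K hK => ?_, h.tendsto_rgrad hρ hp, h.tendsto_rgrad_half hρ hp⟩
  rw [hε hp]
  exact h.exists_norm_rgrad_half_le_sqrt hρ hp (hB X Xh h) hFbar hK
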